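/- **Theorem 4.1 (Full rank theorem).** Let $n\ge 1$, let $\mathbb{S}^n\subset\mathbb{R}^{n+1}$ be the unit sphere with its standard round metric, and let $D$, $D^2$, $\Delta$ and $d\sigma$ denote its gradient (covariant derivative), Hessian, Laplace operator and area element. Let $f:\mathbb{S}^n\to(0,\infty)$ be smooth and such that (1) $f$ is even, i.e. $f(-x)=f(x)$ for all $x\in\mathbb{S}^n$; (2) the matrix $$D^2(f^{-1})-|D f^{-1}|\,I+\frac{f^{-1}}{\frac{8}{n}\max_{\mathbb{S}^n}f+2}\,I$$ is positive semi-definite at every point of $\mathbb{S}^n$. Let $\varphi:\mathbb{S}^n\to(0,\infty)$ be an even function of class $C^4$ that solves $$\Delta\varphi-\frac n2\frac{|D\varphi|^2}{\varphi}+\frac n2\Big(\varphi-\frac1\varphi\Big)=\varphi^{-1}f\qquad\text{on }\mathbb{S}^n ,$$ and put $$U[\varphi]=D^2\varphi-\frac12\frac{|D\varphi|^2}{\varphi}I+\frac12\Big(\varphi-\frac1\varphi\Big)I .$$ Suppose that $\varphi$ is $h$-convex, i.e. $U[\varphi]$ is positive semi-definite at every point of $\mathbb{S}^n$, and that for every integer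 $0\le k\le n-1$ $$\int_{\mathbb{S}^n}\varphi^{k-n}\sigma_{k+1}(U[\varphi])\,d\sigma=\frac{\binom{n}{k+1}}{\binom{n}{k}}\int_{\mathbb{S}^n}\Big[\frac{|D\varphi|^2}{2\varphi}+\frac12\big(\varphi-\varphi^{-1}\big)\Big]\varphi^{k-n}\sigma_k(U[\varphi])\,d\sigma ,$$ where $\sigma_k(A)$ is the $k$-th elementary symmetric function of the eigenvalues of the symmetric matrix $A$, and $\sigma_0=1$. Then $\varphi$ is uniformly $h$-convex, i.e. $U[\varphi]$ is positive definite at every point of $\mathbb{S}^n$ (so $\varphi$ is an even, uniformly $h$-convex solution of the equation). -/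

import Mathlib

open scoped Manifold ContDiff RealInnerProductSpace

namespace HypChristoffel

/-- The ambient Euclidean space `ℝⁿ⁺¹`. -/
abbrev Amb (n : ℕ) : Type := EuclideanSpace ℝ (Fin (n + 1))

/-- The unit sphere `𝕊ⁿ ⊂ ℝⁿ⁺¹`. -/
abbrev Sph (n : ℕ) : Type := Metric.sphere (0 : Amb n) 1

/-- The tangent space `T_x 𝕊ⁿ = x^⊥`, an `n`-dimensional inner product space whose inner product
is the value at `x` of the standard round metric. -/
noncomputable abbrev Tan {n : ℕ} (x : Sph n) : Submodule ℝ (Amb n) := (ℝ ∙ (x : Amb n))ᗮ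

open Classical in
/-- The extension of a function on the sphere to `ℝⁿ⁺¹ ∖ {0}` that is constant along rays,
`y ↦ f (y / |y|)` (the value at the origin plays no role). -/
noncomputable def radExt {n : ℕ} (f : Sph n → ℝ) (y : Amb n) : ℝ :=
  if h : y ≠ 0 then f ⟨‖y‖⁻¹ • y, by simp [norm_smul, h]⟩ else 0

/-- The ambient gradient of the radially constant extension. At points of the sphere its radial
part vanishes, so that it is there the gradient vector field `Df` of the round sphere. -/
noncomputable def gradField {n : ℕ} (f : Sph n → ℝ) (y : Amb n) : Amb n :=
  gradient (radExt f) y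

/-- The gradient `Df(x) ∈ T_x 𝕊ⁿ`. -/
noncomputable def grad {n : ℕ} (f : Sph n → ℝ) (x : Sph n) : Tan x :=
  (Tan x).orthogonalProjectionOnto (gradField f x)

/-- The Hessian `D²f(x)`, as the endomorphism `v ↦ D_v (Df)` of `T_x 𝕊ⁿ`. The Levi-Civita
connection `D` of the round sphere is the tangential part of the ambient derivative. -/
noncomputable def hess {n : ℕ} (f : Sph n → ℝ) (x : Sph n) : Tan x →ₗ[ℝ] Tan x :=
  ((Tan x).orthogonalProjectionOnto ∘L fderiv ℝ (gradField f) x ∘L (Tan x).subtypeL : Tan x →L[ℝ] Tan x)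

/-- The Laplace–Beltrami operator `Δf = tr D²f`. -/
noncomputable def lap {n : ℕ} (f : Sph n → ℝ) (x : Sph n) : ℝ :=
  LinearMap.trace ℝ (Tan x) (hess f x)

/-- `U[φ] = D²φ - ½ (|Dφ|²/φ) I + ½ (φ - 1/φ) I`. -/
noncomputable def U {n : ℕ} (φ : Sph n → ℝ) (x : Sph n) : Tan x →ₗ[ℝ] Tan x :=
  hess φ x - ((1 / 2) * (‖grad φ x‖ ^ 2 / φ x)) • LinearMap.id
    + ((1 / 2) * (φ x - 1 / φ x)) • LinearMap.id

/-- Positive definiteness of an endomorphism of a real inner product space. -/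
def PosDef {V : Type*} [NormedAddCommGroup V] [InnerProductSpace ℝ V] (A : V →ₗ[ℝ] V) : Prop :=
  A.IsSymmetric ∧ ∀ v : V, v ≠ 0 → 0 < ⟪A v, v⟫

/-- `σ_k(A)`: the `k`-th elementary symmetric function of the eigenvalues of `A`, counted with
multiplicity (`σ_0 = 1`). -/
noncomputable def sigma {V : Type*} [NormedAddCommGroup V] [InnerProductSpace ℝ V]
    [FiniteDimensional ℝ V] (k : ℕ) (A : V →ₗ[ℝ] V) : ℝ :=
  A.charpoly.roots.esymm k

/-- The area measure of `𝕊ⁿ`. -/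
noncomputable def area (n : ℕ) : MeasureTheory.Measure (Sph n) :=
  (MeasureTheory.volume : MeasureTheory.Measure (Amb n)).toSphere

/-- Even functions on the sphere. -/
def IsEven {n : ℕ} (f : Sph n → ℝ) : Prop := ∀ x, f (-x) = f x

/-- The matrix `D²(f⁻¹) - |D f⁻¹| I + f⁻¹ / ((8/n) max f + 2) I` is positive semi-definite
everywhere. -/
def CurvCondition {n : ℕ} (f : Sph n → ℝ) : Prop :=
  ∀ x : Sph n,
    (hess (fun y => (f y)⁻¹) x - ‖grad (fun y => (f y)⁻¹) x‖ • LinearMap.id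
      + ((f x)⁻¹ / (8 / (n : ℝ) * (⨆ y, f y) + 2)) • LinearMap.id : Tan x →ₗ[ℝ] Tan x).IsPositive

/-- Positive (classical, `C⁴`) solutions of
`Δφ - (n/2) |Dφ|²/φ + (n/2) (φ - 1/φ) = φ⁻¹ f`. -/
structure IsSolution {n : ℕ} (f φ : Sph n → ℝ) : Prop where
  contMDiff : ContMDiff (𝓡 n) 𝓘(ℝ, ℝ) 4 φ
  pos : ∀ x, 0 < φ x
  eqn : ∀ x, lap φ x - (n : ℝ) / 2 * (‖grad φ x‖ ^ 2 / φ x)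
    + (n : ℝ) / 2 * (φ x - 1 / φ x) = (φ x)⁻¹ * f x

/-- `h`-convex solutions: `U[φ]` is positive semi-definite everywhere. -/
def IsHConvexSolution {n : ℕ} (f φ : Sph n → ℝ) : Prop :=
  IsSolution f φ ∧ ∀ x, (U φ x).IsPositive

/-- Uniformly `h`-convex solutions: `U[φ]` is positive definite everywhere. -/
def IsUniformlyHConvexSolution {n : ℕ} (f φ : Sph n → ℝ) : Prop :=
  IsSolution f φ ∧ ∀ x, PosDef (U φ x)

/-- The integral identities relating consecutive `σ_k(U[φ])`, `0 ≤ k ≤ n - 1`. -/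
def IntegralIdentity {n : ℕ} (φ : Sph n → ℝ) : Prop :=
  ∀ k : ℕ, k < n →
    ∫ x, φ x ^ ((k : ℤ) - (n : ℤ)) * sigma (k + 1) (U φ x) ∂(area n)
      = ((n.choose (k + 1) : ℝ) / (n.choose k : ℝ)) *
        ∫ x, (‖grad φ x‖ ^ 2 / (2 * φ x) + (1 / 2) * (φ x - (φ x)⁻¹))
          * φ x ^ ((k : ℤ) - (n : ℤ)) * sigma k (U φ x) ∂(area n)

end HypChristoffel

namespace HypChristoffel

set_option maxSynthPendingDepth 5

open Filter Topology Module InnerProductSpace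
open scoped Gradient Laplacian

local notation:max "D²" Φ:max => fderiv ℝ (fderiv ℝ Φ)
local notation:max "D³" Φ:max => fderiv ℝ (fderiv ℝ (fderiv ℝ Φ))
local notation:max "D⁴" Φ:max => fderiv ℝ (fderiv ℝ (fderiv ℝ (fderiv ℝ Φ)))

/-! The one-homogeneous extension `Φ y = |y| φ (y / |y|)` has tangential Hessian `D²φ + φ I` at the
points of the sphere, so there `U[φ] = D²Φ - A I` on tangent vectors, with
`A = ½ (φ + φ⁻¹ + φ⁻¹ |Dφ|²)`.

Suppose that a unit tangent vector `e` at `x` lies in the kernel of `U[φ] ≥ 0`. The values of these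
nonnegative forms on the vectors `e + t ξ` at the points `x + t l` have a minimum at `t = 0`. Take
`ξ = -s l - (⟪l, e⟫ / Φ x) ∇Φ x` in the second-order condition and sum over an orthonormal basis of
vectors `l`: the fourth derivatives become second derivatives of `tr U[φ]`, and optimising in `s`
gives a differential inequality for `1 / tr U[φ]` in the direction `e`. The equation says
`tr U[φ] = φ⁻¹ f`, so with `g = f⁻¹` the inequality reads `φ² D²g(e, e) + g ≤ φ |Dφ| |Dg|`.

By `h`-convexity `φ` lies above the function with `U = 0` that touches it to first order at a given
point, which is seen along great circles. Antipodally, evenness turns this into `|Dφ| ≤ φ`; at a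
maximum point it gives `1 + max φ² ≤ 2 max φ min φ`, which together with the equation at a minimum
point yields `φ² < (8 / n) max f + 2`. Hence `φ² (D²g(e, e) - |Dg|) + g ≤ 0` contradicts the
condition on `D²g - |Dg|`. -/

section IteratedDerivatives

variable {E F : Type*} [NormedAddCommGroup E] [NormedSpace ℝ E]
  [NormedAddCommGroup F] [NormedSpace ℝ F] {x : E}

theorem contDiffAt_fderiv_fderiv {G : E → F} {m k : WithTop ℕ∞} (hG : ContDiffAt ℝ k G x)
    (hmk : m + 2 ≤ k) : ContDiffAt ℝ m (D² G) x :=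
  (hG.fderiv_right (m := m + 1) (by rwa [add_assoc, one_add_one_eq_two])).fderiv_right le_rfl

theorem differentiableAt_fderiv {G : E → F} (hG : ContDiffAt ℝ 2 G x) :
    DifferentiableAt ℝ (fderiv ℝ G) x :=
  (hG.fderiv_right (m := 1) (by norm_num)).differentiableAt (by norm_num)

theorem differentiableAt_fderiv_fderiv {G : E → F} (hG : ContDiffAt ℝ 3 G x) :
    DifferentiableAt ℝ (D² G) x :=
  (contDiffAt_fderiv_fderiv (m := 1) hG (by norm_num)).differentiableAt (by norm_num)

theorem fderiv_apply_const {G : E → E →L[ℝ] F} (hG : DifferentiableAt ℝ G x) (v l : E) :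
    fderiv ℝ (fun y => G y v) x l = fderiv ℝ G x l v := by
  simp [fderiv_clm_apply hG (differentiableAt_const v)]

theorem fderiv_apply_const₂ {G : E → E →L[ℝ] E →L[ℝ] F} (hG : DifferentiableAt ℝ G x)
    (v w l : E) : fderiv ℝ (fun y => G y v w) x l = fderiv ℝ G x l v w := by
  rw [fderiv_apply_const (hG.clm_apply (differentiableAt_const v)), fderiv_apply_const hG]

theorem fderiv_fderiv_apply_const₂ {G : E → E →L[ℝ] E →L[ℝ] F} (hG : ContDiffAt ℝ 2 G x)
    (v w l m : E) : D² (fun y => G y v w) x l m = D² G x l m v w := by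
  have hscalar : ContDiffAt ℝ 2 (fun y => G y v w) x :=
    (hG.clm_apply contDiffAt_const).clm_apply contDiffAt_const
  have hfirst : (fun y => fderiv ℝ (fun y => G y v w) y m) =ᶠ[𝓝 x]
      fun y => fderiv ℝ G y m v w := by
    filter_upwards [hG.eventually (by simp)] with y hy
      using fderiv_apply_const₂ (hy.differentiableAt (by norm_num)) v w m
  have hG' := differentiableAt_fderiv hG
  rw [← fderiv_apply_const (differentiableAt_fderiv hscalar), hfirst.fderiv_eq,
    fderiv_apply_const₂ (hG'.clm_apply (differentiableAt_const m)), fderiv_apply_const hG']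

theorem fderiv_apply_comm {G : E → E →L[ℝ] E →L[ℝ] F} (hG : DifferentiableAt ℝ G x) {v w : E}
    (h : ∀ᶠ y in 𝓝 x, G y v w = G y w v) (l : E) :
    fderiv ℝ G x l v w = fderiv ℝ G x l w v := by
  rw [← fderiv_apply_const₂ hG, EventuallyEq.fderiv_eq h, fderiv_apply_const₂ hG]

theorem fderiv_fderiv_comm {G : E → F} (hG : ContDiffAt ℝ 2 G x) (v w : E) :
    D² G x v w = D² G x w v :=
  hG.isSymmSndFDerivAt (by simp) v w

theorem fderiv_fderiv_sub {g h : E → F} (hg : ContDiffAt ℝ 2 g x) (hh : ContDiffAt ℝ 2 h x) :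
    D² (fun y => g y - h y) x = D² g x - D² h x := by
  have hfirst : fderiv ℝ (fun y => g y - h y) =ᶠ[𝓝 x] fun y => fderiv ℝ g y - fderiv ℝ h y := by
    filter_upwards [hg.eventually (by simp), hh.eventually (by simp)] with y hgy hhy
    exact fderiv_fun_sub (hgy.differentiableAt (by norm_num)) (hhy.differentiableAt (by norm_num))
  rw [hfirst.fderiv_eq, fderiv_fun_sub (differentiableAt_fderiv hg) (differentiableAt_fderiv hh)]

theorem fderiv_fderiv_mul_self {g h : E → ℝ} (hg : ContDiffAt ℝ 2 g x) (hh : ContDiffAt ℝ 2 h x)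
    (l : E) :
    D² (fun y => g y * h y) x l l
      = D² g x l l * h x + 2 * (fderiv ℝ g x l * fderiv ℝ h x l) + g x * D² h x l l := by
  have hg' := differentiableAt_fderiv hg
  have hh' := differentiableAt_fderiv hh
  have hfirst : fderiv ℝ (fun y => g y * h y) =ᶠ[𝓝 x]
      fun y => g y • fderiv ℝ h y + h y • fderiv ℝ g y := by
    filter_upwards [hg.eventually (by simp), hh.eventually (by simp)] with y hgy hhy
    exact fderiv_fun_mul (hgy.differentiableAt (by norm_num)) (hhy.differentiableAt (by norm_num))
  have hgx := hg.differentiableAt (by norm_num)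
  have hhx := hh.differentiableAt (by norm_num)
  rw [hfirst.fderiv_eq, fderiv_fun_add (hgx.fun_smul hh') (hhx.fun_smul hg'),
    fderiv_fun_smul hgx hh', fderiv_fun_smul hhx hg']
  simp only [add_apply, smul_apply, ContinuousLinearMap.smulRight_apply, smul_eq_mul]
  ring

theorem fderiv_inv_self {g : E → ℝ} (hg : DifferentiableAt ℝ g x) (hx : g x ≠ 0) (l : E) :
    fderiv ℝ (fun y => (g y)⁻¹) x l = -fderiv ℝ g x l / g x ^ 2 := by
  have h := (hasDerivAt_inv hx).comp_hasFDerivAt x hg.hasFDerivAt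
  rw [show (fun y => (g y)⁻¹) = Inv.inv ∘ g from rfl, h.fderiv]
  simp only [neg_smul, neg_apply, smul_apply, smul_eq_mul]
  ring

theorem fderiv_fderiv_inv_self {g : E → ℝ} (hg : ContDiffAt ℝ 2 g x) (hx : g x ≠ 0) (l : E) :
    D² (fun y => (g y)⁻¹) x l l = 2 * fderiv ℝ g x l ^ 2 / g x ^ 3 - D² g x l l / g x ^ 2 := by
  have hone : D² (fun y => g y * (g y)⁻¹) x l l = 0 := by
    have h : (fun y => g y * (g y)⁻¹) =ᶠ[𝓝 x] fun _ => 1 := by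
      filter_upwards [hg.continuousAt.eventually_ne hx] with y hy using mul_inv_cancel₀ hy
    rw [h.fderiv.fderiv_eq]
    simp
  rw [fderiv_fderiv_mul_self (h := fun y => (g y)⁻¹) hg (hg.inv hx),
    fderiv_inv_self (hg.differentiableAt (by norm_num)) hx] at hone
  field_simp at hone ⊢
  linarith

variable {Φ : E → F}

theorem third_fderiv_comm_left (h : ContDiffAt ℝ 3 Φ x) (u v : E) :
    D³ Φ x u v = D³ Φ x v u :=
  ContinuousLinearMap.ext fun w => by
    rw [fderiv_fderiv_comm (h.fderiv_right (by norm_num))]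

theorem third_fderiv_comm_right (h : ContDiffAt ℝ 3 Φ x) (u v w : E) :
    D³ Φ x u v w = D³ Φ x u w v := by
  refine fderiv_apply_comm (differentiableAt_fderiv_fderiv h) ?_ u
  filter_upwards [h.eventually (by simp)] with y hy
    using fderiv_fderiv_comm (hy.of_le (by norm_num)) v w

theorem fourth_fderiv_comm (h : ContDiffAt ℝ 4 Φ x) (l e : E) :
    D⁴ Φ x l l e e = D⁴ Φ x e e l l := by
  have h₂ : ContDiffAt ℝ 2 (D² Φ) x := contDiffAt_fderiv_fderiv h (by norm_num)
  have h₃ : DifferentiableAt ℝ (D³ Φ) x := differentiableAt_fderiv h₂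
  have hev : ∀ᶠ y in 𝓝 x, ContDiffAt ℝ 3 Φ y := by
    filter_upwards [h.eventually (by simp)] with y hy using hy.of_le (by norm_num)
  have hmiddle (a b c : E) : D⁴ Φ x a b c = D⁴ Φ x a c b :=
    fderiv_apply_comm h₃ (hev.mono fun y hy => third_fderiv_comm_left hy b c) a
  have hright (a b c d : E) : D⁴ Φ x a b c d = D⁴ Φ x a b d c := by
    rw [← fderiv_apply_const h₃]
    exact fderiv_apply_comm (h₃.clm_apply (differentiableAt_const b))
      (hev.mono fun y hy => third_fderiv_comm_right hy b c d) a
  rw [hmiddle, fderiv_fderiv_comm h₂, hright, hmiddle]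

end IteratedDerivatives

section SecondVariation

variable {E : Type*} [NormedAddCommGroup E] [NormedSpace ℝ E] {x l : E}

theorem tendsto_line (x l : E) : Tendsto (fun t : ℝ => x + t • l) (𝓝 0) (𝓝 x) :=
  Continuous.tendsto' (by fun_prop) _ _ (by simp)

theorem hasDerivAt_comp_line {F : Type*} [NormedAddCommGroup F] [NormedSpace ℝ F] {G : E → F}
    {t : ℝ} (hG : DifferentiableAt ℝ G (x + t • l)) :
    HasDerivAt (fun s : ℝ => G (x + s • l)) (fderiv ℝ G (x + t • l) l) t :=
  hG.hasFDerivAt.comp_hasDerivAt t (by simpa using ((hasDerivAt_id t).smul_const l).const_add x)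

theorem hasDerivAt_mul_of_continuousAt {k : ℝ → ℝ} (hk : ContinuousAt k 0) :
    HasDerivAt (fun t => t * k t) (k 0) 0 := by
  rw [hasDerivAt_iff_tendsto_slope_zero]
  refine (hk.tendsto.mono_left nhdsWithin_le_nhds).congr' ?_
  filter_upwards [self_mem_nhdsWithin] with t ht
  have : t ≠ 0 := ht
  simp [this]

theorem tendsto_div_sq_comp_line {α : E → ℝ} (hα : ContDiffAt ℝ 2 α x) (h₀ : α x = 0)
    (h₁ : fderiv ℝ α x l = 0) :
    Tendsto (fun t : ℝ => α (x + t • l) / t ^ 2) (𝓝[≠] 0) (𝓝 (D² α x l l / 2)) := by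
  have hline : Tendsto (fun t : ℝ => x + t • l) (𝓝[≠] 0) (𝓝 x) :=
    (tendsto_line x l).mono_left nhdsWithin_le_nhds
  have hder : ∀ᶠ t : ℝ in 𝓝[≠] 0,
      HasDerivAt (fun s : ℝ => α (x + s • l)) (fderiv ℝ α (x + t • l) l) t :=
    hline.eventually ((hα.eventually (by simp)).mono fun y hy =>
      hy.differentiableAt (by norm_num)) |>.mono fun t ht => hasDerivAt_comp_line ht
  have hslope : HasDerivAt (fun s : ℝ => fderiv ℝ α (x + s • l) l) (D² α x l l) 0 := by
    have hd := differentiableAt_fderiv hα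
    have h := hasDerivAt_comp_line (x := x) (l := l) (t := 0) (G := fun y => fderiv ℝ α y l)
      (by simpa using hd.clm_apply (differentiableAt_const l))
    rwa [zero_smul, add_zero, fderiv_apply_const hd] at h
  refine HasDerivAt.lhopital_zero_nhdsNE hder
    (Eventually.of_forall fun t => by simpa using hasDerivAt_pow 2 t) ?_ ?_ ?_ ?_
  · filter_upwards [self_mem_nhdsWithin] with t ht
    exact mul_ne_zero two_ne_zero ht
  · simpa [Function.comp_def, h₀] using hα.continuousAt.tendsto.comp hline
  · exact (Continuous.tendsto' (by fun_prop) _ _ (by simp)).mono_left nhdsWithin_le_nhds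
  · have h := hslope.tendsto_slope_zero.div_const 2
    refine h.congr fun t => ?_
    simp only [zero_add, zero_smul, add_zero, h₁, sub_zero, smul_eq_mul]
    ring

theorem second_variation {α β γ : E → ℝ} (hα : ContDiffAt ℝ 2 α x) (hα₀ : α x = 0)
    (hβ : DifferentiableAt ℝ β x) (hβ₀ : β x = 0) (hγ : ContinuousAt γ x)
    (h : ∀ᶠ t : ℝ in 𝓝 0,
      0 ≤ α (x + t • l) + 2 * t * β (x + t • l) + t ^ 2 * γ (x + t • l)) :
    fderiv ℝ α x l = 0 ∧ 0 ≤ D² α x l l + 4 * fderiv ℝ β x l + 2 * γ x := by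
  have hline := tendsto_line x l
  have hγ' : Tendsto (fun t : ℝ => γ (x + t • l)) (𝓝 0) (𝓝 (γ x)) := hγ.tendsto.comp hline
  have hβ' : HasDerivAt (fun t : ℝ => β (x + t • l)) (fderiv ℝ β x l) 0 := by
    simpa using hasDerivAt_comp_line (t := 0) (x := x) (l := l) (G := β) (by simpa using hβ)
  have hα' : HasDerivAt (fun t : ℝ => α (x + t • l)) (fderiv ℝ α x l) 0 := by
    simpa using hasDerivAt_comp_line (t := 0) (x := x) (l := l) (G := α)
      (by simpa using hα.differentiableAt (by norm_num))
  have hfirst : fderiv ℝ α x l = 0 := by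
    have hk : ContinuousAt (fun t : ℝ => 2 * β (x + t • l) + t * γ (x + t • l)) 0 := by
      have hγ₀ : ContinuousAt (fun t : ℝ => γ (x + t • l)) 0 := by simpa [ContinuousAt] using hγ'
      exact (continuousAt_const.mul hβ'.continuousAt).add (continuousAt_id.mul hγ₀)
    have hsum := hα'.add (hasDerivAt_mul_of_continuousAt hk)
    have hmin : IsLocalMin ((fun t : ℝ => α (x + t • l)) +
        fun t : ℝ => t * (2 * β (x + t • l) + t * γ (x + t • l))) 0 := by
      filter_upwards [h] with t ht
      simp only [Pi.add_apply, zero_smul, add_zero, hα₀, zero_mul]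
      linarith
    simpa [hβ₀] using hmin.hasDerivAt_eq_zero hsum
  refine ⟨hfirst, ?_⟩
  have hlim := ((tendsto_div_sq_comp_line hα hα₀ hfirst).add
    (hβ'.tendsto_slope_zero.const_mul 2)).add (hγ'.mono_left nhdsWithin_le_nhds)
  have hnonneg := ge_of_tendsto hlim (b := 0) <| by
    filter_upwards [h.filter_mono nhdsWithin_le_nhds, self_mem_nhdsWithin] with t ht hne
    have hne : t ≠ 0 := hne
    have := div_nonneg ht (sq_nonneg t)
    simp only [zero_add, zero_smul, add_zero, hβ₀, sub_zero, smul_eq_mul]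
    convert this using 1
    field_simp
  linarith

end SecondVariation

section GradientLaplacian

variable {E : Type*} [NormedAddCommGroup E] [InnerProductSpace ℝ E]
variable {x : E} {Φ : E → ℝ}

section Gradient

variable [CompleteSpace E]

theorem contDiffAt_gradient {m k : WithTop ℕ∞} (h : ContDiffAt ℝ k Φ x) (hmk : m + 1 ≤ k) :
    ContDiffAt ℝ m (∇ Φ) x :=
  ((toDual ℝ E).symm.toContinuousLinearEquiv : StrongDual ℝ E ≃L[ℝ] E).contDiff.contDiffAt.comp x
    (h.fderiv_right hmk)

theorem differentiableAt_gradient (h : ContDiffAt ℝ 2 Φ x) : DifferentiableAt ℝ (∇ Φ) x :=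
  (contDiffAt_gradient (m := 1) h (by norm_num)).differentiableAt (by norm_num)

theorem inner_fderiv_gradient (h : ContDiffAt ℝ 2 Φ x) (v w : E) :
    ⟪fderiv ℝ (∇ Φ) x v, w⟫ = D² Φ x v w := by
  have heq := fderiv_inner_apply ℝ (differentiableAt_gradient h) (differentiableAt_const w) v
  simp only [inner_gradient_left] at heq
  rw [fderiv_apply_const (differentiableAt_fderiv h)] at heq
  simpa using heq.symm

theorem fderiv_norm_sq_gradient (h : ContDiffAt ℝ 2 Φ x) (v : E) :
    fderiv ℝ (fun y => ‖∇ Φ y‖ ^ 2) x v = 2 * D² Φ x v (∇ Φ x) := by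
  have hgrad := differentiableAt_gradient h
  have := fderiv_inner_apply ℝ hgrad hgrad v
  simp only [real_inner_self_eq_norm_sq] at this
  rw [this, real_inner_comm, inner_fderiv_gradient h, two_mul]

theorem fderiv_fderiv_norm_sq_gradient (h : ContDiffAt ℝ 3 Φ x) (l : E) :
    D² (fun y => ‖∇ Φ y‖ ^ 2) x l l
      = 2 * (‖fderiv ℝ (∇ Φ) x l‖ ^ 2 + D³ Φ x l l (∇ Φ x)) := by
  have h₂ : ContDiffAt ℝ 2 Φ x := h.of_le (by norm_num)
  have hgrad := differentiableAt_gradient h₂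
  have hH := differentiableAt_fderiv_fderiv h
  have hsq := differentiableAt_fderiv ((contDiffAt_gradient h (m := 2) (by norm_num)).norm_sq ℝ)
  have hfirst : (fun y => fderiv ℝ (fun y => ‖∇ Φ y‖ ^ 2) y l)
      =ᶠ[𝓝 x] fun y => 2 * D² Φ y l (∇ Φ y) := by
    filter_upwards [h₂.eventually (by simp)] with y hy using fderiv_norm_sq_gradient hy l
  have hHl := hH.clm_apply (differentiableAt_const l)
  rw [← fderiv_apply_const hsq, hfirst.fderiv_eq, fderiv_const_mul (hHl.clm_apply hgrad),
    fderiv_clm_apply hHl hgrad]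
  simp [fderiv_apply_const hH, ← inner_fderiv_gradient h₂, mul_add]

end Gradient

section Laplacian

variable [FiniteDimensional ℝ E] {ι : Type*} [Fintype ι]

theorem laplacian_eq_sum_fderiv_fderiv (b : OrthonormalBasis ι ℝ E) (Φ : E → ℝ) :
    Δ Φ = fun y => ∑ i, D² Φ y (b i) (b i) := by
  rw [laplacian_eq_iteratedFDeriv_orthonormalBasis Φ b]
  simp [iteratedFDeriv_two_apply]

theorem contDiffAt_laplacian {m k : WithTop ℕ∞} (h : ContDiffAt ℝ k Φ x) (hmk : m + 2 ≤ k) :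
    ContDiffAt ℝ m (Δ Φ) x := by
  rw [laplacian_eq_sum_fderiv_fderiv (stdOrthonormalBasis ℝ E)]
  exact ContDiffAt.sum fun i _ =>
    ((contDiffAt_fderiv_fderiv h hmk).clm_apply contDiffAt_const).clm_apply contDiffAt_const

theorem fderiv_laplacian (b : OrthonormalBasis ι ℝ E) (h : ContDiffAt ℝ 3 Φ x) (l : E) :
    fderiv ℝ (Δ Φ) x l = ∑ i, D³ Φ x l (b i) (b i) := by
  have hH := differentiableAt_fderiv_fderiv h
  rw [laplacian_eq_sum_fderiv_fderiv b, fderiv_fun_sum fun i _ =>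
    (hH.clm_apply (differentiableAt_const _)).clm_apply (differentiableAt_const _)]
  simp [fderiv_apply_const₂ hH]

theorem fderiv_fderiv_laplacian (b : OrthonormalBasis ι ℝ E) (h : ContDiffAt ℝ 4 Φ x) (l : E) :
    D² (Δ Φ) x l l = ∑ i, D⁴ Φ x l l (b i) (b i) := by
  have hfirst : (fun y => fderiv ℝ (Δ Φ) y l) =ᶠ[𝓝 x] fun y => ∑ i, D³ Φ y l (b i) (b i) := by
    filter_upwards [h.eventually (by simp)] with y hy
      using fderiv_laplacian b (hy.of_le (by norm_num)) l
  have hT : DifferentiableAt ℝ (D³ Φ) x :=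
    differentiableAt_fderiv (contDiffAt_fderiv_fderiv h (by norm_num))
  have hTl := hT.clm_apply (differentiableAt_const l)
  rw [← fderiv_apply_const (differentiableAt_fderiv (contDiffAt_laplacian h (by norm_num))),
    hfirst.fderiv_eq, fderiv_fun_sum fun i _ =>
      (hTl.clm_apply (differentiableAt_const _)).clm_apply (differentiableAt_const _)]
  simp [fderiv_apply_const₂ hTl, fderiv_apply_const hT]

end Laplacian

end GradientLaplacian

section Homogeneity

variable {E F : Type*} [NormedAddCommGroup E] [NormedSpace ℝ E]
  [NormedAddCommGroup F] [NormedSpace ℝ F] {G : E → F} {y : E}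

theorem fderiv_smul_of_homogeneous {a c : ℝ} (hc : c ≠ 0) (h : ∀ z, z ≠ 0 → G (c • z) = a • G z)
    (hy : y ≠ 0) : fderiv ℝ G (c • y) = (c⁻¹ * a) • fderiv ℝ G y := by
  have heq : (fun z => G (c • z)) =ᶠ[𝓝 y] fun z => a • G z := by
    filter_upwards [isOpen_ne.mem_nhds hy] with z hz using h z hz
  have hderiv := heq.fderiv_eq (𝕜 := ℝ)
  rw [fderiv_comp_smul, show fderiv ℝ (fun z => a • G z) y = a • fderiv ℝ G y from
    congrFun (fderiv_const_smul_field (𝕜 := ℝ) (f := G) a) y] at hderiv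
  rw [mul_smul, ← hderiv, inv_smul_smul₀ hc]

theorem fderiv_self_of_homogeneous {a : ℝ → ℝ} {a' : ℝ}
    (h : ∀ c : ℝ, 0 < c → G (c • y) = a c • G y) (ha : HasDerivAt a a' 1)
    (hG : DifferentiableAt ℝ G y) : fderiv ℝ G y y = a' • G y := by
  have hray : HasDerivAt (fun c : ℝ => c • y) y 1 := by
    simpa using (hasDerivAt_id (1 : ℝ)).smul_const y
  have hcomp : HasDerivAt (fun c : ℝ => G (c • y)) (fderiv ℝ G y y) 1 :=
    HasFDerivAt.comp_hasDerivAt 1 (by simpa using hG.hasFDerivAt) hray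
  refine hcomp.unique ((ha.smul_const (G y)).congr_of_eventuallyEq ?_)
  filter_upwards [lt_mem_nhds (zero_lt_one : (0 : ℝ) < 1)] with c hc using h c hc

end Homogeneity

section HoroConvex

variable {E : Type*} [NormedAddCommGroup E] [InnerProductSpace ℝ E] [FiniteDimensional ℝ E]
  {Φ : E → ℝ} {x y : E}

/-- For a one-homogeneous `Φ` with restriction `φ` to the unit sphere, this is
`½ (φ + φ⁻¹ (1 + |Dφ|²))` there, since `|∇Φ|² = φ² + |Dφ|²`. If `log φ` is the horospherical support
function of a domain of hyperbolic space, it is the hyperbolic cosine of the distance from the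
origin to the boundary point with normal `y`. -/
noncomputable def horoCosh (Φ : E → ℝ) (y : E) : ℝ := (1 + ‖∇ Φ y‖ ^ 2) / (2 * Φ y)

/-- Positive one-homogeneous functions `Φ` on `E ∖ {0}` whose restriction `φ` to the unit sphere is
`h`-convex: as the tangential Hessian of `Φ` is `D²φ + φ I`, the last field says that `U[φ]` is
positive semi-definite. -/
structure IsHoroConvex (Φ : E → ℝ) : Prop where
  contDiffAt : ∀ y, y ≠ 0 → ContDiffAt ℝ 4 Φ y
  pos : ∀ y, y ≠ 0 → 0 < Φ y
  homogeneous : ∀ c : ℝ, 0 < c → ∀ y, y ≠ 0 → Φ (c • y) = c • Φ y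
  horoCosh_le : ∀ y v, ‖y‖ = 1 → ⟪v, y⟫ = 0 → horoCosh Φ y * ‖v‖ ^ 2 ≤ D² Φ y v v

theorem contDiffAt_horoCosh (hΦ : ContDiffAt ℝ 4 Φ y) (hy : Φ y ≠ 0) :
    ContDiffAt ℝ 3 (horoCosh Φ) y :=
  (contDiffAt_const.add ((contDiffAt_gradient hΦ (by norm_num)).norm_sq ℝ)).div
    (contDiffAt_const.mul (hΦ.of_le (by norm_num))) (by positivity)

theorem norm_sq_gradient_eq (hy : Φ y ≠ 0) : ‖∇ Φ y‖ ^ 2 = 2 * (Φ y * horoCosh Φ y) - 1 := by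
  rw [horoCosh]
  field_simp
  ring

theorem fderiv_norm_sq_gradient_eventuallyEq (hΦ : ContDiffAt ℝ 4 Φ y) (hy : Φ y ≠ 0) :
    fderiv ℝ (fun z => ‖∇ Φ z‖ ^ 2)
      =ᶠ[𝓝 y] (2 : ℝ) • fderiv ℝ fun z => Φ z * horoCosh Φ z := by
  have heq : (fun z => ‖∇ Φ z‖ ^ 2)
      =ᶠ[𝓝 y] fun z => ((2 : ℝ) • fun z => Φ z * horoCosh Φ z) z - 1 := by
    filter_upwards [hΦ.continuousAt.eventually_ne hy] with z hz using norm_sq_gradient_eq hz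
  filter_upwards [heq.fderiv (𝕜 := ℝ)] with z hz
  rw [hz, fderiv_sub_const, fderiv_const_smul_field (2 : ℝ)]

theorem fderiv_mul_horoCosh (hΦ : ContDiffAt ℝ 4 Φ y) (hy : Φ y ≠ 0) (l : E) :
    fderiv ℝ Φ y l * horoCosh Φ y + Φ y * fderiv ℝ (horoCosh Φ) y l = D² Φ y l (∇ Φ y) := by
  have h := DFunLike.congr_fun (fderiv_norm_sq_gradient_eventuallyEq hΦ hy).self_of_nhds l
  rw [fderiv_norm_sq_gradient (hΦ.of_le (by norm_num)), Pi.smul_apply,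
    fderiv_fun_mul (hΦ.differentiableAt (by norm_num))
      ((contDiffAt_horoCosh hΦ hy).differentiableAt (by norm_num))] at h
  simp only [smul_add, add_apply, smul_apply, smul_eq_mul] at h
  linarith

theorem fderiv_fderiv_mul_horoCosh (hΦ : ContDiffAt ℝ 4 Φ y) (hy : Φ y ≠ 0) (l : E) :
    D² Φ y l l * horoCosh Φ y + 2 * (fderiv ℝ Φ y l * fderiv ℝ (horoCosh Φ) y l)
        + Φ y * D² (horoCosh Φ) y l l
      = ‖fderiv ℝ (∇ Φ) y l‖ ^ 2 + D³ Φ y l l (∇ Φ y) := by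
  have h := DFunLike.congr_fun (DFunLike.congr_fun
    ((fderiv_norm_sq_gradient_eventuallyEq hΦ hy).fderiv_eq (𝕜 := ℝ)) l) l
  rw [fderiv_fderiv_norm_sq_gradient (hΦ.of_le (by norm_num)), fderiv_const_smul_field (2 : ℝ)] at h
  simp only [Pi.smul_apply, _root_.smul_apply, smul_eq_mul] at h
  rw [fderiv_fderiv_mul_self (hΦ.of_le (by norm_num))
    ((contDiffAt_horoCosh hΦ hy).of_le (by norm_num))] at h
  linarith

namespace IsHoroConvex

variable (hΦ : IsHoroConvex Φ)
include hΦ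

theorem fderiv_smul {c : ℝ} (hc : 0 < c) (hy : y ≠ 0) : fderiv ℝ Φ (c • y) = fderiv ℝ Φ y := by
  rw [fderiv_smul_of_homogeneous hc.ne' (hΦ.homogeneous c hc) hy, inv_mul_cancel₀ hc.ne', one_smul]

theorem hess_smul {c : ℝ} (hc : 0 < c) (hy : y ≠ 0) : D² Φ (c • y) = c⁻¹ • D² Φ y := by
  rw [fderiv_smul_of_homogeneous (a := 1) hc.ne'
    (fun z hz => by rw [hΦ.fderiv_smul hc hz, one_smul]) hy, mul_one]

theorem horoCosh_smul {c : ℝ} (hc : 0 < c) (hy : y ≠ 0) :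
    horoCosh Φ (c • y) = c⁻¹ * horoCosh Φ y := by
  rw [horoCosh, horoCosh, gradient, gradient, hΦ.fderiv_smul hc hy, hΦ.homogeneous c hc y hy,
    smul_eq_mul]
  field_simp

theorem fderiv_self (hy : y ≠ 0) : fderiv ℝ Φ y y = Φ y := by
  simpa using fderiv_self_of_homogeneous (fun c hc => hΦ.homogeneous c hc y hy) (hasDerivAt_id 1)
    ((hΦ.contDiffAt y hy).differentiableAt (by norm_num))

theorem hess_comm (hy : y ≠ 0) (v w : E) : D² Φ y v w = D² Φ y w v :=
  fderiv_fderiv_comm ((hΦ.contDiffAt y hy).of_le (by norm_num)) v w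

theorem hess_self_left (hy : y ≠ 0) (v : E) : D² Φ y y v = 0 := by
  rw [fderiv_self_of_homogeneous (a := fun _ => 1) (fun c hc => by
      rw [hΦ.fderiv_smul hc hy, one_smul]) (hasDerivAt_const 1 1)
      (differentiableAt_fderiv ((hΦ.contDiffAt y hy).of_le (by norm_num)))]
  simp

theorem hess_self_right (hy : y ≠ 0) (v : E) : D² Φ y v y = 0 := by
  rw [hΦ.hess_comm hy, hΦ.hess_self_left hy]

theorem horoCosh_mul_le (hy : y ≠ 0) (v : E) :
    horoCosh Φ y * (‖v‖ ^ 2 - ⟪v, y⟫ ^ 2 / ‖y‖ ^ 2) ≤ D² Φ y v v := by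
  have hpos : 0 < ‖y‖ := norm_pos_iff.mpr hy
  have hc : 0 < ‖y‖⁻¹ := inv_pos.mpr hpos
  set w := v - (⟪v, y⟫ / ‖y‖ ^ 2) • y with hw
  have hwy : ⟪w, y⟫ = 0 := by
    rw [hw, inner_sub_left, real_inner_smul_left, real_inner_self_eq_norm_sq]
    field_simp
    ring
  have hnorm : ‖w‖ ^ 2 = ‖v‖ ^ 2 - ⟪v, y⟫ ^ 2 / ‖y‖ ^ 2 := by
    rw [hw, norm_sub_sq_real, norm_smul, real_inner_smul_right, Real.norm_eq_abs, mul_pow, sq_abs]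
    field_simp
    ring
  have hhess : D² Φ y w w = D² Φ y v v := by
    simp [hw, hΦ.hess_self_left hy, hΦ.hess_self_right hy]
  have hunit := hΦ.horoCosh_le (‖y‖⁻¹ • y) w
    (by rw [norm_smul, norm_inv, norm_norm, inv_mul_cancel₀ hpos.ne'])
    (by rw [real_inner_smul_right, hwy, mul_zero])
  rw [hΦ.horoCosh_smul hc hy, hΦ.hess_smul hc hy, mul_assoc] at hunit
  rw [← hnorm, ← hhess]
  exact le_of_mul_le_mul_left hunit (inv_pos.mpr hc)

end IsHoroConvex

end HoroConvex

section NullDirection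

variable {E : Type*} [NormedAddCommGroup E] [InnerProductSpace ℝ E] [FiniteDimensional ℝ E]
  {Φ : E → ℝ} {x e : E}

/-- `e` is a unit tangent vector to the unit sphere at `x` in the kernel of `U[φ]`, where `φ` is the
restriction of `Φ` to the sphere. -/
structure IsNullDirection (Φ : E → ℝ) (x e : E) : Prop where
  norm_point : ‖x‖ = 1
  norm_eq : ‖e‖ = 1
  inner_eq : ⟪e, x⟫ = 0
  hess_eq : D² Φ x e e = horoCosh Φ x

/-- The trace of `U[φ]`, extended to `E ∖ {0}` with homogeneity `-1`. -/
noncomputable def horoTrace (Φ : E → ℝ) (y : E) : ℝ :=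
  Δ Φ y - (finrank ℝ E - 1) * horoCosh Φ y

theorem IsHoroConvex.horoTrace_smul (hΦ : IsHoroConvex Φ) {c : ℝ} (hc : 0 < c) (hx : x ≠ 0) :
    horoTrace Φ (c • x) = c⁻¹ * horoTrace Φ x := by
  simp only [horoTrace, hΦ.horoCosh_smul hc hx,
    laplacian_eq_sum_fderiv_fderiv (stdOrthonormalBasis ℝ E), hΦ.hess_smul hc hx,
    _root_.smul_apply, smul_eq_mul, ← Finset.mul_sum]
  ring

theorem eq_zero_of_forall_quadratic_nonneg {b c : ℝ} (h : ∀ t : ℝ, 0 ≤ c * (t * t) + b * t) :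
    b = 0 := by
  have := discrim_le_zero (a := c) (b := b) (c := 0) (by simpa using h)
  rw [discrim, mul_zero, sub_zero] at this
  exact pow_eq_zero_iff two_ne_zero |>.mp (le_antisymm this (sq_nonneg b))

namespace IsNullDirection

theorem point_ne_zero (he : IsNullDirection Φ x e) : x ≠ 0 :=
  norm_ne_zero_iff.mp (by rw [he.norm_point]; exact one_ne_zero)

variable (hΦ : IsHoroConvex Φ) (he : IsNullDirection Φ x e)
include hΦ he

theorem contDiffAt : ContDiffAt ℝ 4 Φ x := hΦ.contDiffAt x he.point_ne_zero

theorem pos : 0 < Φ x := hΦ.pos x he.point_ne_zero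

theorem contDiffAt_horoCosh : ContDiffAt ℝ 3 (horoCosh Φ) x :=
  HypChristoffel.contDiffAt_horoCosh (he.contDiffAt hΦ) (he.pos hΦ).ne'

theorem hess_apply (v : E) : D² Φ x e v = horoCosh Φ x * ⟪e, v⟫ := by
  have hx := he.point_ne_zero
  suffices hlinear : 2 * (D² Φ x e v - horoCosh Φ x * ⟪e, v⟫) = 0 by linarith
  refine eq_zero_of_forall_quadratic_nonneg
    (c := D² Φ x v v - horoCosh Φ x * (‖v‖ ^ 2 - ⟪v, x⟫ ^ 2)) fun t => ?_
  have h := hΦ.horoCosh_mul_le hx (e + t • v)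
  simp only [norm_add_sq_real, inner_add_left, real_inner_smul_left, real_inner_smul_right,
    norm_smul, Real.norm_eq_abs, mul_pow, sq_abs, he.norm_eq, he.norm_point, he.inner_eq, map_add,
    map_smul, _root_.add_apply, _root_.smul_apply, smul_eq_mul, he.hess_eq,
    hΦ.hess_comm hx v e] at h
  linarith

theorem second_variation (l ξ : E) :
    D³ Φ x l e e = fderiv ℝ (horoCosh Φ) x l ∧
      0 ≤ D⁴ Φ x l l e e - D² (horoCosh Φ) x l l
        + 4 * (D³ Φ x l e ξ - fderiv ℝ (horoCosh Φ) x l * ⟪e, ξ⟫)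
        + 2 * (D² Φ x ξ ξ - horoCosh Φ x * ‖ξ‖ ^ 2
          + horoCosh Φ x * (⟪e, l⟫ + ⟪ξ, x⟫) ^ 2) := by
  have hx := he.point_ne_zero
  have hΦx := he.contDiffAt hΦ
  have hH : ContDiffAt ℝ 2 (D² Φ) x := contDiffAt_fderiv_fderiv hΦx (by norm_num)
  have hH' := hH.differentiableAt (by norm_num)
  have hA : ContDiffAt ℝ 2 (horoCosh Φ) x := (he.contDiffAt_horoCosh hΦ).of_le (by norm_num)
  have hA' := hA.differentiableAt (by norm_num)
  have hHe (v : E) : ContDiffAt ℝ 2 (fun y => D² Φ y e v) x :=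
    (hH.clm_apply contDiffAt_const).clm_apply contDiffAt_const
  have hvar := HypChristoffel.second_variation (x := x) (l := l)
    (α := fun y => D² Φ y e e - horoCosh Φ y)
    (β := fun y => D² Φ y e ξ - horoCosh Φ y * ⟪e, ξ⟫)
    (γ := fun y => D² Φ y ξ ξ - horoCosh Φ y * ‖ξ‖ ^ 2
      + horoCosh Φ y * ((⟪e, l⟫ + ⟪ξ, y⟫) ^ 2 / ‖y‖ ^ 2))
    ((hHe e).sub hA) (sub_eq_zero.mpr he.hess_eq)
    (((hHe ξ).differentiableAt (by norm_num)).sub (hA'.mul_const _))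
    (sub_eq_zero.mpr (he.hess_apply hΦ ξ)) ?_ ?_
  · rw [fderiv_fun_sub ((hHe e).differentiableAt (by norm_num)) hA', fderiv_fderiv_sub (hHe e) hA,
      fderiv_fun_sub ((hHe ξ).differentiableAt (by norm_num)) (hA'.mul_const _),
      fderiv_mul_const hA'] at hvar
    simp only [_root_.sub_apply, _root_.smul_apply, smul_eq_mul, fderiv_apply_const₂ hH',
      fderiv_fderiv_apply_const₂ hH, he.norm_point, one_pow, div_one] at hvar
    exact ⟨sub_eq_zero.mp hvar.1, by linarith [hvar.2]⟩
  · have hHξ : ContinuousAt (fun y => D² Φ y ξ ξ) x :=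
      (hH'.continuousAt.clm_apply continuousAt_const).clm_apply continuousAt_const
    have hA₀ := hA'.continuousAt
    fun_prop (disch := simpa using hx)
  · filter_upwards [(tendsto_line x l).eventually (isOpen_ne.mem_nhds hx)] with t ht
    have h := hΦ.horoCosh_mul_le ht (e + t • ξ)
    have he' : ⟪e, x + t • l⟫ = t * ⟪e, l⟫ := by
      rw [inner_add_right, he.inner_eq, real_inner_smul_right, zero_add]
    rw [norm_add_sq_real, inner_add_left, he', real_inner_smul_left, real_inner_smul_right,
      norm_smul, Real.norm_eq_abs, mul_pow, sq_abs, he.norm_eq] at h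
    simp only [map_add, map_smul, _root_.add_apply, _root_.smul_apply, smul_eq_mul,
      hΦ.hess_comm ht ξ e] at h
    field_simp at h ⊢
    linarith

end IsNullDirection

end NullDirection

section KeyInequality

variable {E : Type*} [NormedAddCommGroup E] [InnerProductSpace ℝ E] {ι : Type*} [Fintype ι]
  {Φ : E → ℝ} {x e : E}

theorem sum_inner_mul_apply (b : OrthonormalBasis ι ℝ E) (L : E →L[ℝ] ℝ) (v : E) :
    ∑ i, ⟪b i, v⟫ * L (b i) = L v := by
  conv_rhs => rw [← b.sum_repr' v, map_sum]
  simp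

variable [FiniteDimensional ℝ E]

theorem IsHoroConvex.two_mul_laplacian_le (hΦ : IsHoroConvex Φ) (hx : ‖x‖ = 1)
    (b : OrthonormalBasis ι ℝ E) :
    2 * horoCosh Φ x * Δ Φ x - (finrank ℝ E - 1) * horoCosh Φ x ^ 2
      ≤ ∑ i, ‖fderiv ℝ (∇ Φ) x (b i)‖ ^ 2 := by
  have hx₀ : x ≠ 0 := norm_ne_zero_iff.mp (by rw [hx]; exact one_ne_zero)
  have hΦ₂ : ContDiffAt ℝ 2 Φ x := (hΦ.contDiffAt x hx₀).of_le (by norm_num)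
  have hexpand (i : ι) :
      ‖fderiv ℝ (∇ Φ) x (b i) - horoCosh Φ x • (b i - ⟪b i, x⟫ • x)‖ ^ 2
        = ‖fderiv ℝ (∇ Φ) x (b i)‖ ^ 2 - 2 * horoCosh Φ x * D² Φ x (b i) (b i)
          + horoCosh Φ x ^ 2 * (1 - ⟪b i, x⟫ ^ 2) := by
    have hproj : ‖b i - ⟪b i, x⟫ • x‖ ^ 2 = 1 - ⟪b i, x⟫ ^ 2 := by
      rw [norm_sub_sq_real, real_inner_smul_right, norm_smul, hx, b.norm_eq_one, Real.norm_eq_abs,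
        mul_one, sq_abs]
      ring
    rw [norm_sub_sq_real, norm_smul, mul_pow, hproj, Real.norm_eq_abs, sq_abs,
      inner_fderiv_gradient hΦ₂]
    simp only [map_smul, map_sub, hΦ.hess_self_right hx₀, smul_eq_mul, mul_zero, sub_zero]
    ring
  have hnonneg := Finset.sum_nonneg fun i (_ : i ∈ Finset.univ) =>
    sq_nonneg ‖fderiv ℝ (∇ Φ) x (b i) - horoCosh Φ x • (b i - ⟪b i, x⟫ • x)‖
  have hcard : (Fintype.card ι : ℝ) = finrank ℝ E := by rw [finrank_eq_card_basis b.toBasis]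
  simp only [hexpand, Finset.sum_add_distrib, Finset.sum_sub_distrib, ← Finset.mul_sum,
    b.sum_sq_inner_right, hx, Finset.sum_const, Finset.card_univ, nsmul_eq_mul, hcard] at hnonneg
  rw [laplacian_eq_sum_fderiv_fderiv b]
  linarith

theorem fderiv_horoTrace (hΦ : IsHoroConvex Φ) (hx : x ≠ 0) (l : E) :
    fderiv ℝ (horoTrace Φ) x l
      = fderiv ℝ (Δ Φ) x l - (finrank ℝ E - 1) * fderiv ℝ (horoCosh Φ) x l := by
  have hΔ : DifferentiableAt ℝ (Δ Φ) x :=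
    (contDiffAt_laplacian (m := 2) (hΦ.contDiffAt x hx) (by norm_num)).differentiableAt
      (by norm_num)
  have hA : DifferentiableAt ℝ (horoCosh Φ) x :=
    (contDiffAt_horoCosh (hΦ.contDiffAt x hx) (hΦ.pos x hx).ne').differentiableAt (by norm_num)
  unfold horoTrace
  rw [fderiv_fun_sub hΔ (hA.const_mul _), fderiv_const_mul hA]
  simp

theorem fderiv_fderiv_horoTrace (hΦ : IsHoroConvex Φ) (hx : x ≠ 0) (l : E) :
    D² (horoTrace Φ) x l l
      = D² (Δ Φ) x l l - (finrank ℝ E - 1) * D² (horoCosh Φ) x l l := by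
  have hΔ : ContDiffAt ℝ 2 (Δ Φ) x := contDiffAt_laplacian (hΦ.contDiffAt x hx) (by norm_num)
  have hA : ContDiffAt ℝ 2 (horoCosh Φ) x :=
    (contDiffAt_horoCosh (hΦ.contDiffAt x hx) (hΦ.pos x hx).ne').of_le (by norm_num)
  have hfirst : fderiv ℝ (fun y => ((finrank ℝ E : ℝ) - 1) * horoCosh Φ y)
      = ((finrank ℝ E : ℝ) - 1) • fderiv ℝ (horoCosh Φ) :=
    fderiv_const_smul_field ((finrank ℝ E : ℝ) - 1)
  unfold horoTrace
  rw [fderiv_fderiv_sub hΔ (contDiffAt_const.mul hA), hfirst, fderiv_const_smul_field]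
  simp

theorem IsHoroConvex.mul_laplacian_horoCosh_ge (hΦ : IsHoroConvex Φ) (hx : ‖x‖ = 1) :
    horoCosh Φ x * horoTrace Φ x + (finrank ℝ E - 3) * fderiv ℝ (horoCosh Φ) x (∇ Φ x)
        + fderiv ℝ (horoTrace Φ) x (∇ Φ x)
      ≤ Φ x * Δ (horoCosh Φ) x := by
  have hx₀ : x ≠ 0 := norm_ne_zero_iff.mp (by rw [hx]; exact one_ne_zero)
  have hΦx := hΦ.contDiffAt x hx₀
  have hΦ₃ : ContDiffAt ℝ 3 Φ x := hΦx.of_le (by norm_num)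
  let b := stdOrthonormalBasis ℝ E
  have hthird : ∑ i, D³ Φ x (b i) (b i) (∇ Φ x) = fderiv ℝ (Δ Φ) x (∇ Φ x) := by
    rw [fderiv_laplacian b hΦ₃]
    exact Finset.sum_congr rfl fun i _ => by
      rw [third_fderiv_comm_right hΦ₃, third_fderiv_comm_left hΦ₃]
  have hmixed : ∑ i, fderiv ℝ Φ x (b i) * fderiv ℝ (horoCosh Φ) x (b i)
      = fderiv ℝ (horoCosh Φ) x (∇ Φ x) := by
    rw [← sum_inner_mul_apply b]
    exact Finset.sum_congr rfl fun i _ => by rw [real_inner_comm, inner_gradient_left]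
  have htrace := Finset.sum_congr rfl fun i (_ : i ∈ Finset.univ) =>
    fderiv_fderiv_mul_horoCosh hΦx (hΦ.pos x hx₀).ne' (b i)
  have hle := hΦ.two_mul_laplacian_le hx b
  have hΔΦ : Δ Φ x = ∑ i, D² Φ x (b i) (b i) :=
    congrFun (laplacian_eq_sum_fderiv_fderiv b Φ) x
  have hΔA : Δ (horoCosh Φ) x = ∑ i, D² (horoCosh Φ) x (b i) (b i) :=
    congrFun (laplacian_eq_sum_fderiv_fderiv b _) x
  simp only [Finset.sum_add_distrib, ← Finset.sum_mul, ← Finset.mul_sum, hthird, hmixed, ← hΔΦ,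
    ← hΔA] at htrace
  rw [fderiv_horoTrace hΦ hx₀, horoTrace]
  linarith

namespace IsNullDirection

variable (hΦ : IsHoroConvex Φ) (he : IsNullDirection Φ x e)
include hΦ he

theorem fderiv_horoCosh_apply : fderiv ℝ (horoCosh Φ) x e = 0 := by
  have h := fderiv_mul_horoCosh (he.contDiffAt hΦ) (he.pos hΦ).ne' e
  rw [he.hess_apply hΦ, real_inner_comm, inner_gradient_left] at h
  exact (mul_eq_zero.mp (by linarith)).resolve_left (he.pos hΦ).ne'

theorem fderiv_gradient_apply : fderiv ℝ (∇ Φ) x e = horoCosh Φ x • e :=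
  ext_inner_right ℝ fun v => by
    rw [inner_fderiv_gradient ((he.contDiffAt hΦ).of_le (by norm_num)), he.hess_apply hΦ,
      real_inner_smul_left]

theorem third_apply (l : E) : D³ Φ x e e l = fderiv ℝ (horoCosh Φ) x l := by
  have hΦ₃ : ContDiffAt ℝ 3 Φ x := (he.contDiffAt hΦ).of_le (by norm_num)
  rw [third_fderiv_comm_right hΦ₃, third_fderiv_comm_left hΦ₃, (he.second_variation hΦ l 0).1]

theorem mul_fderiv_fderiv_horoCosh :
    Φ x * D² (horoCosh Φ) x e e = fderiv ℝ (horoCosh Φ) x (∇ Φ x) := by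
  have h := fderiv_fderiv_mul_horoCosh (he.contDiffAt hΦ) (he.pos hΦ).ne' e
  rw [he.hess_eq, he.fderiv_horoCosh_apply hΦ, he.fderiv_gradient_apply hΦ, he.third_apply hΦ,
    norm_smul, he.norm_eq, Real.norm_eq_abs, mul_pow, sq_abs] at h
  linarith

theorem hess_gradient_gradient :
    D² Φ x (∇ Φ x) (∇ Φ x)
      = horoCosh Φ x * ‖∇ Φ x‖ ^ 2 + Φ x * fderiv ℝ (horoCosh Φ) x (∇ Φ x) := by
  rw [← fderiv_mul_horoCosh (he.contDiffAt hΦ) (he.pos hΦ).ne', ← inner_gradient_left,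
    real_inner_self_eq_norm_sq, mul_comm (horoCosh Φ x)]

-- This is `second_variation` with `ξ = -s l - (⟪l, e⟫ / Φ x) ∇Φ x`; the multiple of `∇Φ x` is
-- chosen so that `⟪e, l⟫` cancels in `⟪e, l⟫ + ⟪ξ, x⟫`.
theorem second_variation_smul_add_gradient (l : E) (s : ℝ) :
    0 ≤ D⁴ Φ x e e l l - D² (horoCosh Φ) x l l
      - 4 * s * D³ Φ x e l l - 4 / Φ x * (⟪l, e⟫ * D³ Φ x e (∇ Φ x) l)
      + 4 * (s + ⟪∇ Φ x, e⟫ / Φ x) * (⟪l, e⟫ * fderiv ℝ (horoCosh Φ) x l)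
      + 2 * s ^ 2 * D² Φ x l l + 4 * s / Φ x * (⟪l, e⟫ * D² Φ x (∇ Φ x) l)
      + 2 / Φ x * fderiv ℝ (horoCosh Φ) x (∇ Φ x) * ⟪l, e⟫ ^ 2
      - 2 * horoCosh Φ x * s ^ 2 * (‖l‖ ^ 2 - ⟪l, x⟫ ^ 2)
      - 4 * horoCosh Φ x * s / Φ x * (⟪l, e⟫ * ⟪∇ Φ x, l⟫) := by
  have hx := he.point_ne_zero
  have hpos := he.pos hΦ
  have hΦ₃ : ContDiffAt ℝ 3 Φ x := (he.contDiffAt hΦ).of_le (by norm_num)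
  have h := (he.second_variation hΦ l (-(s • l) - (⟪l, e⟫ / Φ x) • ∇ Φ x)).2
  have hradial : ⟪e, l⟫ + ⟪-(s • l) - (⟪l, e⟫ / Φ x) • ∇ Φ x, x⟫ = -(s * ⟪l, x⟫) := by
    rw [inner_sub_left, inner_neg_left, real_inner_smul_left, real_inner_smul_left,
      inner_gradient_left, hΦ.fderiv_self hx, div_mul_cancel₀ _ hpos.ne', real_inner_comm]
    ring
  have hnorm : ‖-(s • l) - (⟪l, e⟫ / Φ x) • ∇ Φ x‖ ^ 2
      = s ^ 2 * ‖l‖ ^ 2 + 2 * s * (⟪l, e⟫ / Φ x) * ⟪∇ Φ x, l⟫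
        + (⟪l, e⟫ / Φ x) ^ 2 * ‖∇ Φ x‖ ^ 2 := by
    rw [norm_sub_sq_real, norm_neg, norm_smul, norm_smul, inner_neg_left, real_inner_smul_left,
      real_inner_smul_right, mul_pow, mul_pow, Real.norm_eq_abs, Real.norm_eq_abs, sq_abs, sq_abs,
      real_inner_comm l (∇ Φ x)]
    ring
  rw [fourth_fderiv_comm (he.contDiffAt hΦ), third_fderiv_comm_left hΦ₃, hradial, hnorm] at h
  simp only [map_sub, map_neg, map_smul, _root_.sub_apply, _root_.neg_apply, _root_.smul_apply,
    smul_eq_mul, inner_sub_right, inner_neg_right, real_inner_smul_right,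
    hΦ.hess_comm hx l (∇ Φ x), third_fderiv_comm_right hΦ₃ e l (∇ Φ x),
    he.hess_gradient_gradient hΦ, real_inner_comm l e, real_inner_comm (∇ Φ x) e] at h
  convert h using 1
  field_simp
  ring

theorem second_variation_trace (s : ℝ) :
    0 ≤ D² (Δ Φ) x e e - Δ (horoCosh Φ) x - 4 * s * fderiv ℝ (Δ Φ) x e
      - 2 / Φ x * fderiv ℝ (horoCosh Φ) x (∇ Φ x) + 2 * s ^ 2 * horoTrace Φ x := by
  have hpos := he.pos hΦ
  have hΦ₃ : ContDiffAt ℝ 3 Φ x := (he.contDiffAt hΦ).of_le (by norm_num)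
  let b := stdOrthonormalBasis ℝ E
  have hsum := Finset.sum_nonneg fun i (_ : i ∈ Finset.univ) =>
    he.second_variation_smul_add_gradient hΦ (b i) s
  have hcard : (Fintype.card (Fin (finrank ℝ E)) : ℝ) = finrank ℝ E := by rw [Fintype.card_fin]
  have hinner : ∑ i, ⟪b i, e⟫ * ⟪∇ Φ x, b i⟫ = ⟪∇ Φ x, e⟫ :=
    sum_inner_mul_apply b (innerSL ℝ (∇ Φ x)) e
  have hΔΦ : Δ Φ x = ∑ i, D² Φ x (b i) (b i) :=
    congrFun (laplacian_eq_sum_fderiv_fderiv b Φ) x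
  have hΔA : Δ (horoCosh Φ) x = ∑ i, D² (horoCosh Φ) x (b i) (b i) :=
    congrFun (laplacian_eq_sum_fderiv_fderiv b _) x
  simp only [Finset.sum_add_distrib, Finset.sum_sub_distrib, ← Finset.mul_sum,
    sum_inner_mul_apply b, hinner, b.sum_sq_inner_right, b.norm_eq_one, he.norm_point, he.norm_eq,
    Finset.sum_const, Finset.card_univ, nsmul_eq_mul, hcard, ← fderiv_laplacian b hΦ₃,
    ← fderiv_fderiv_laplacian b (he.contDiffAt hΦ), ← hΔΦ, ← hΔA, he.fderiv_horoCosh_apply hΦ,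
    third_fderiv_comm_right hΦ₃ e (∇ Φ x) e, he.third_apply hΦ,
    hΦ.hess_comm he.point_ne_zero (∇ Φ x) e, he.hess_apply hΦ, real_inner_comm (∇ Φ x) e] at hsum
  rw [horoTrace]
  field_simp at hsum ⊢
  linarith

theorem horoTrace_quadratic_nonneg (s : ℝ) :
    0 ≤ D² (horoTrace Φ) x e e
      - (horoCosh Φ x * horoTrace Φ x + fderiv ℝ (horoTrace Φ) x (∇ Φ x)) / Φ x
      - 4 * s * fderiv ℝ (horoTrace Φ) x e + 2 * s ^ 2 * horoTrace Φ x := by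
  have hpos := he.pos hΦ
  have htrace := he.second_variation_trace hΦ s
  have hΔA := hΦ.mul_laplacian_horoCosh_ge he.norm_point
  have hAee := he.mul_fderiv_fderiv_horoCosh hΦ
  rw [fderiv_fderiv_horoTrace hΦ he.point_ne_zero, fderiv_horoTrace hΦ he.point_ne_zero e,
    he.fderiv_horoCosh_apply hΦ]
  field_simp at htrace ⊢
  linear_combination htrace + hΔA + (finrank ℝ E - 1) * hAee

end IsNullDirection

end KeyInequality

section Barrier

variable {E : Type*} [NormedAddCommGroup E] [InnerProductSpace ℝ E] [FiniteDimensional ℝ E]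
  {Φ ρ g : E → ℝ} {x e : E}

namespace IsNullDirection

variable (hΦ : IsHoroConvex Φ) (he : IsNullDirection Φ x e)
include hΦ he

theorem mul_fderiv_fderiv_inv_horoTrace_le (hρ : ContDiffAt ℝ 2 ρ x) (hρx : 0 < ρ x)
    (htr : horoTrace Φ =ᶠ[𝓝 x] fun y => (ρ y)⁻¹) :
    Φ x * D² ρ x e e + horoCosh Φ x * ρ x ≤ fderiv ℝ ρ x (∇ Φ x) := by
  have hpos := he.pos hΦ
  have hρ' := hρ.differentiableAt (by norm_num)
  have h := he.horoTrace_quadratic_nonneg hΦ (-fderiv ℝ ρ x e / ρ x)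
  rw [(htr.fderiv (𝕜 := ℝ)).fderiv_eq, htr.fderiv_eq, htr.self_of_nhds,
    fderiv_fderiv_inv_self hρ hρx.ne', fderiv_inv_self hρ' hρx.ne',
    fderiv_inv_self hρ' hρx.ne'] at h
  field_simp at h
  exact le_of_mul_le_mul_left (by linarith) hρx

theorem fderiv_fderiv_le (hg : ContDiffAt ℝ 2 g x) (hgx : 0 < g x)
    (htr : horoTrace Φ =ᶠ[𝓝 x] fun y => (Φ y * g y)⁻¹) :
    Φ x ^ 2 * D² g x e e + g x
      ≤ Φ x * (fderiv ℝ g x (∇ Φ x) - 2 * (fderiv ℝ Φ x e * fderiv ℝ g x e)) := by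
  have hpos := he.pos hΦ
  have hΦ₂ : ContDiffAt ℝ 2 Φ x := (he.contDiffAt hΦ).of_le (by norm_num)
  have h := he.mul_fderiv_fderiv_inv_horoTrace_le hΦ (hΦ₂.mul hg) (mul_pos hpos hgx) htr
  have hgrad : fderiv ℝ Φ x (∇ Φ x) = 2 * (Φ x * horoCosh Φ x) - 1 := by
    rw [← norm_sq_gradient_eq hpos.ne', ← inner_gradient_left, real_inner_self_eq_norm_sq]
  rw [fderiv_fderiv_mul_self hΦ₂ hg, fderiv_fun_mul (hΦ₂.differentiableAt (by norm_num))
    (hg.differentiableAt (by norm_num)), he.hess_eq] at h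
  simp only [_root_.add_apply, _root_.smul_apply, smul_eq_mul, hgrad] at h
  linarith

end IsNullDirection

end Barrier

section HoroConvexCurve

open Set Real

variable {p p' p'' : ℝ → ℝ} {t T : ℝ}

theorem hasDerivAt_curveCosh (hp : HasDerivAt p (p' t) t) (hp' : HasDerivAt p' (p'' t) t)
    (hpos : 0 < p t) :
    HasDerivAt (fun t => (1 + p' t ^ 2 + p t ^ 2) / (2 * p t))
      (p' t / p t * (p'' t + p t - (1 + p' t ^ 2 + p t ^ 2) / (2 * p t))) t := by
  refine ((((hp'.fun_pow 2).const_add 1).fun_add (hp.fun_pow 2)).fun_div (hp.const_mul 2)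
    (by positivity)).congr_deriv ?_
  field_simp
  ring

variable (hp : ∀ t, HasDerivAt p (p' t) t) (hp' : ∀ t, HasDerivAt p' (p'' t) t)
  (hpos : ∀ t, 0 < p t) (hconv : ∀ t, (1 + p' t ^ 2 + p t ^ 2) / (2 * p t) ≤ p'' t + p t)
  (hT : T ≤ 2 * π) (h₀ : 0 ≤ p 0 * cos (T / 2) + p' 0 * sin (T / 2))
include hp hp' hpos hconv hT h₀

theorem half_angle_nonneg (ht : t ∈ Icc 0 T) :
    0 ≤ p t * cos ((T - t) / 2) + p' t * sin ((T - t) / 2) := by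
  have hθ (t : ℝ) : HasDerivAt (fun t => (T - t) / 2) (-1 / 2) t :=
    ((hasDerivAt_id t).const_sub T).div_const 2
  have hk (t : ℝ) := (((hp t).fun_mul (hθ t).cos).fun_add ((hp' t).fun_mul (hθ t).sin)).fun_div
    ((hp t).sqrt (hpos t).ne') (sqrt_pos.mpr (hpos t)).ne'
  have hmono : MonotoneOn
      (fun t => (p t * cos ((T - t) / 2) + p' t * sin ((T - t) / 2)) / √(p t)) (Icc 0 T) := by
    refine monotoneOn_of_hasDerivWithinAt_nonneg (convex_Icc 0 T)
      (fun t _ => (hk t).continuousAt.continuousWithinAt) (fun t _ => (hk t).hasDerivWithinAt)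
      fun t ht => ?_
    rw [interior_Icc] at ht
    have hsin : 0 ≤ sin ((T - t) / 2) :=
      sin_nonneg_of_nonneg_of_le_pi (by linarith [ht.2]) (by linarith [ht.1])
    have hP := hpos t
    have hgap : 0 ≤ (2 * p t * (p'' t + p t) - (1 + p' t ^ 2 + p t ^ 2)) := by
      have := hconv t
      rw [div_le_iff₀ (by positivity)] at this
      linarith
    refine (div_nonneg (mul_nonneg (add_nonneg hgap zero_le_one) hsin)
      (mul_nonneg (mul_nonneg zero_le_two hP.le) (sqrt_nonneg (p t)))).trans_eq ?_
    field_simp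
    rw [sq_sqrt hP.le]
    ring
  have h := hmono (left_mem_Icc.mpr (ht.1.trans ht.2)) ht ht.1
  simp only [sub_zero] at h
  by_contra! hneg
  exact (div_neg_of_neg_of_pos hneg (sqrt_pos.mpr (hpos t))).not_ge
    ((div_nonneg h₀ (sqrt_nonneg _)).trans h)

theorem le_of_horoConvexCurve (hT₀ : 0 ≤ T) :
    (1 + p' 0 ^ 2 + p 0 ^ 2) / (2 * p 0) * (1 - cos T) + p 0 * cos T + p' 0 * sin T ≤ p T := by
  have hθ (t : ℝ) : HasDerivAt (fun t => T - t) (-1) t := (hasDerivAt_id t).const_sub T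
  have hh (t : ℝ) := (((hasDerivAt_curveCosh (hp t) (hp' t) (hpos t)).fun_mul
    ((hθ t).cos.const_sub 1)).fun_add ((hp t).fun_mul (hθ t).cos)).fun_add
      ((hp' t).fun_mul (hθ t).sin)
  have hmono : MonotoneOn (fun t => (1 + p' t ^ 2 + p t ^ 2) / (2 * p t) * (1 - cos (T - t))
      + p t * cos (T - t) + p' t * sin (T - t)) (Icc 0 T) := by
    refine monotoneOn_of_hasDerivWithinAt_nonneg (convex_Icc 0 T)
      (fun t _ => (hh t).continuousAt.continuousWithinAt) (fun t _ => (hh t).hasDerivWithinAt)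
      fun t ht => ?_
    rw [interior_Icc] at ht
    have hsin : 0 ≤ sin ((T - t) / 2) :=
      sin_nonneg_of_nonneg_of_le_pi (by linarith [ht.2]) (by linarith [ht.1])
    have hk := half_angle_nonneg hp hp' hpos hconv hT h₀ (Ioo_subset_Icc_self ht)
    have hP := hpos t
    have hprod := mul_nonneg (mul_nonneg (sub_nonneg.mpr (hconv t)) (div_nonneg hsin hP.le)) hk
    have hsin2 : sin (T - t) = 2 * sin ((T - t) / 2) * cos ((T - t) / 2) := by
      rw [← sin_two_mul, mul_div_cancel₀ _ two_ne_zero]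
    have hcos2 : cos (T - t) = 1 - 2 * sin ((T - t) / 2) ^ 2 := by
      rw [← cos_two_mul_eq_one_sub, mul_div_cancel₀ _ two_ne_zero]
    refine (mul_nonneg zero_le_two hprod).trans_eq ?_
    rw [hsin2, hcos2]
    field_simp
    ring
  simpa using hmono (left_mem_Icc.mpr hT₀) (right_mem_Icc.mpr hT₀) hT₀

end HoroConvexCurve

section GreatCircle

open Real

variable {E : Type*} [NormedAddCommGroup E] [InnerProductSpace ℝ E] {x y v : E} {t T : ℝ}

/-- The great circle through `x` with initial velocity `v`, for orthonormal `x` and `v`; its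
velocity is the great circle `greatCircle v (-x)`. -/
noncomputable def greatCircle (x v : E) (t : ℝ) : E := cos t • x + sin t • v

theorem greatCircle_zero (x v : E) : greatCircle x v 0 = x := by simp [greatCircle]

theorem greatCircle_pi (x v : E) : greatCircle x v π = -x := by simp [greatCircle]

theorem greatCircle_neg_neg (x v : E) (t : ℝ) : greatCircle (-x) (-v) t = -greatCircle x v t := by
  simp only [greatCircle, smul_neg, neg_add]

theorem hasDerivAt_greatCircle (x v : E) (t : ℝ) :
    HasDerivAt (greatCircle x v) (greatCircle v (-x) t) t := by
  refine (((hasDerivAt_cos t).smul_const x).add ((hasDerivAt_sin t).smul_const v)).congr_deriv ?_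
  rw [greatCircle, neg_smul, smul_neg, add_comm]

theorem norm_greatCircle (hx : ‖x‖ = 1) (hv : ‖v‖ = 1) (hvx : ⟪v, x⟫ = 0) :
    ‖greatCircle x v t‖ = 1 := by
  rw [← sq_eq_sq₀ (norm_nonneg _) zero_le_one, greatCircle, norm_add_sq_real, norm_smul, norm_smul,
    mul_pow, mul_pow, hx, hv, real_inner_smul_left, real_inner_smul_right, real_inner_comm, hvx,
    Real.norm_eq_abs, Real.norm_eq_abs, sq_abs, sq_abs]
  linarith [sin_sq_add_cos_sq t]

theorem inner_greatCircle (hx : ‖x‖ = 1) (hv : ‖v‖ = 1) (hvx : ⟪v, x⟫ = 0) :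
    ⟪greatCircle v (-x) t, greatCircle x v t⟫ = 0 := by
  simp only [greatCircle, inner_add_left, inner_add_right, real_inner_smul_left, inner_neg_left,
    real_inner_smul_right, real_inner_self_eq_norm_sq, hx, hv, hvx, smul_neg, real_inner_comm v x]
  ring

theorem exists_eq_norm_smul {w : E} (hw : w ≠ 0) : ∃ v : E, ‖v‖ = 1 ∧ w = ‖w‖ • v :=
  ⟨‖w‖⁻¹ • w, norm_smul_inv_norm (𝕜 := ℝ) hw, by rw [smul_inv_smul₀ (norm_ne_zero_iff.mpr hw)]⟩

theorem exists_greatCircle_eq (hx : ‖x‖ = 1) (hy : ‖y‖ = 1) (hyx : 0 ≤ ⟪y, x⟫) (hne : y ≠ x) :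
    ∃ v : E, ‖v‖ = 1 ∧ ⟪v, x⟫ = 0 ∧ ∃ T, 0 ≤ T ∧ T ≤ π / 2 ∧ greatCircle x v T = y := by
  set c := ⟪y, x⟫
  set w := y - c • x
  have hwx : ⟪w, x⟫ = 0 := by
    rw [inner_sub_left, real_inner_smul_left, real_inner_self_eq_norm_sq, hx]
    ring
  have hnorm : ‖w‖ ^ 2 = 1 - c ^ 2 := by
    rw [norm_sub_sq_real, real_inner_smul_right, norm_smul, hx, hy, mul_one, Real.norm_eq_abs,
      sq_abs]
    ring
  have hc : c ≤ 1 := by simpa [hx, hy] using real_inner_le_norm y x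
  have hw : w ≠ 0 := fun hw => hne <| by
    have : c = 1 := by rw [hw, norm_zero] at hnorm; nlinarith
    rwa [sub_eq_zero, this, one_smul] at hw
  obtain ⟨v, hv, hwv⟩ := exists_eq_norm_smul hw
  refine ⟨v, hv, ?_, arccos c, arccos_nonneg c, arccos_le_pi_div_two.mpr hyx, ?_⟩
  · rw [hwv, real_inner_smul_left] at hwx
    exact (mul_eq_zero.mp hwx).resolve_left (norm_ne_zero_iff.mpr hw)
  · rw [greatCircle, cos_arccos (by linarith) hc, sin_arccos, ← hnorm, sqrt_sq (norm_nonneg w),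
      ← hwv, add_sub_cancel]

theorem inner_sq_add_inner_sq_le {w : E} (hv : ‖v‖ = 1) (hw : ‖w‖ = 1) (hvw : ⟪v, w⟫ = 0) (u : E) :
    ⟪u, v⟫ ^ 2 + ⟪u, w⟫ ^ 2 ≤ ‖u‖ ^ 2 := by
  have h := sq_nonneg ‖u - (⟪u, v⟫ • v + ⟪u, w⟫ • w)‖
  rw [norm_sub_sq_real, norm_add_sq_real, inner_add_right] at h
  simp only [real_inner_smul_left, real_inner_smul_right, norm_smul, hv, hw, hvw, mul_pow,
    Real.norm_eq_abs, sq_abs] at h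
  linarith

variable [FiniteDimensional ℝ E] {Φ : E → ℝ}

namespace IsHoroConvex

theorem greatCircle_comparison (hΦ : IsHoroConvex Φ) (hx : ‖x‖ = 1) (hv : ‖v‖ = 1)
    (hvx : ⟪v, x⟫ = 0) (hT₀ : 0 ≤ T) (hT : T ≤ 2 * π)
    (h₀ : 0 ≤ Φ x * cos (T / 2) + fderiv ℝ Φ x v * sin (T / 2)) :
    (1 + fderiv ℝ Φ x v ^ 2 + Φ x ^ 2) / (2 * Φ x) * (1 - cos T) + Φ x * cos T
      + fderiv ℝ Φ x v * sin T ≤ Φ (greatCircle x v T) := by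
  let γ := greatCircle x v
  let γ' := greatCircle v (-x)
  have hγ (t : ℝ) : ‖γ t‖ = 1 := norm_greatCircle hx hv hvx
  have hγ' (t : ℝ) : ‖γ' t‖ = 1 :=
    norm_greatCircle hv (by rwa [norm_neg]) (by rw [inner_neg_left, real_inner_comm, hvx, neg_zero])
  have hγγ' (t : ℝ) : ⟪γ' t, γ t⟫ = 0 := inner_greatCircle hx hv hvx
  have hne (t : ℝ) : γ t ≠ 0 := norm_ne_zero_iff.mp (by rw [hγ]; exact one_ne_zero)
  have hdγ (t : ℝ) : HasDerivAt γ (γ' t) t := hasDerivAt_greatCircle x v t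
  have hdγ' (t : ℝ) : HasDerivAt γ' (-γ t) t := by
    rw [← greatCircle_neg_neg]
    exact hasDerivAt_greatCircle v (-x) t
  have hp (t : ℝ) : HasDerivAt (fun s => Φ (γ s)) (fderiv ℝ Φ (γ t) (γ' t)) t :=
    ((hΦ.contDiffAt _ (hne t)).differentiableAt
      (by norm_num)).hasFDerivAt.comp_hasDerivAt t (hdγ t)
  have hp' (t : ℝ) : HasDerivAt (fun s => fderiv ℝ Φ (γ s) (γ' s))
      (D² Φ (γ t) (γ' t) (γ' t) - Φ (γ t)) t := by
    refine (((differentiableAt_fderiv ((hΦ.contDiffAt _ (hne t)).of_le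
      (by norm_num))).hasFDerivAt.comp_hasDerivAt t (hdγ t)).clm_apply (hdγ' t)).congr_deriv ?_
    rw [map_neg, Function.comp_apply, hΦ.fderiv_self (hne t), sub_eq_add_neg]
  have hconv (t : ℝ) : (1 + fderiv ℝ Φ (γ t) (γ' t) ^ 2 + Φ (γ t) ^ 2) / (2 * Φ (γ t))
      ≤ D² Φ (γ t) (γ' t) (γ' t) - Φ (γ t) + Φ (γ t) := by
    have hpos := hΦ.pos _ (hne t)
    have hgrad := inner_sq_add_inner_sq_le (hγ' t) (hγ t) (hγγ' t) (∇ Φ (γ t))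
    rw [inner_gradient_left, inner_gradient_left, hΦ.fderiv_self (hne t)] at hgrad
    have hU := hΦ.horoCosh_le (γ t) (γ' t) (hγ t) (hγγ' t)
    rw [hγ', one_pow, mul_one] at hU
    rw [sub_add_cancel]
    refine le_trans ?_ hU
    rw [horoCosh, add_assoc]
    gcongr
  have hγ₀ : γ 0 = x := greatCircle_zero x v
  have hγ'₀ : γ' 0 = v := greatCircle_zero v (-x)
  have h := le_of_horoConvexCurve hp hp' (fun t => hΦ.pos _ (hne t)) hconv hT
  simp only [hγ₀, hγ'₀] at h
  exact h h₀ hT₀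

theorem one_add_fderiv_sq_le (hΦ : IsHoroConvex Φ) (heven : ∀ y, Φ (-y) = Φ y) (hx : ‖x‖ = 1)
    (hv : ‖v‖ = 1) (hvx : ⟪v, x⟫ = 0) : 1 + fderiv ℝ Φ x v ^ 2 ≤ Φ x ^ 2 := by
  have hpos := hΦ.pos x (norm_ne_zero_iff.mp (by rw [hx]; exact one_ne_zero))
  wlog hv₀ : 0 ≤ fderiv ℝ Φ x v generalizing v
  · have h := this (v := -v) (by rwa [norm_neg]) (by rw [inner_neg_left, hvx, neg_zero])
      (by rw [map_neg]; linarith)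
    rwa [map_neg, neg_sq] at h
  have h := hΦ.greatCircle_comparison hx hv hvx pi_nonneg (by linarith [pi_pos]) (by simpa)
  rw [greatCircle_pi, heven, cos_pi, sin_pi] at h
  field_simp at h
  linarith

theorem one_add_sq_le_of_critical (hΦ : IsHoroConvex Φ) (hx : ‖x‖ = 1) (hΦx : 1 ≤ Φ x)
    (hcrit : ∀ v, ⟪v, x⟫ = 0 → fderiv ℝ Φ x v = 0) (hy : ‖y‖ = 1) (hyx : 0 ≤ ⟪y, x⟫) :
    1 + Φ x ^ 2 ≤ 2 * Φ x * Φ y := by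
  rcases eq_or_ne y x with rfl | hne
  · nlinarith
  obtain ⟨v, hv, hvx, T, hT₀, hT, rfl⟩ := exists_greatCircle_eq hx hy hyx hne
  have hcos : 0 ≤ cos T := cos_nonneg_of_neg_pi_div_two_le_of_le (by linarith [pi_pos]) hT
  have hcos' : 0 ≤ cos (T / 2) :=
    cos_nonneg_of_neg_pi_div_two_le_of_le (by linarith [pi_pos]) (by linarith)
  have h := hΦ.greatCircle_comparison hx hv hvx hT₀ (by linarith [pi_pos])
    (by rw [hcrit v hvx, zero_mul, add_zero]; positivity)
  rw [hcrit v hvx] at h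
  field_simp at h
  nlinarith [mul_nonneg hcos (sub_nonneg.mpr (one_le_pow₀ hΦx : 1 ≤ Φ x ^ 2))]

end IsHoroConvex

end GreatCircle

section Norm

variable {E : Type*} [NormedAddCommGroup E] [InnerProductSpace ℝ E] {x w : E}

theorem fderiv_norm_of_inner_eq_zero (hx : ‖x‖ = 1) (hw : ⟪w, x⟫ = 0) :
    fderiv ℝ (fun y : E => ‖y‖) x w = 0 := by
  have hx0 : x ≠ 0 := norm_ne_zero_iff.mp (by rw [hx]; exact one_ne_zero)
  have h := congrArg (· w) (fderiv_norm_sq_apply (F := E) x)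
  rw [show (fun y : E => ‖y‖ ^ 2) = fun y => ‖y‖ * ‖y‖ from funext fun y => sq ‖y‖,
    fderiv_fun_mul (contDiffAt_norm ℝ hx0 |>.differentiableAt one_ne_zero)
      (contDiffAt_norm ℝ hx0 |>.differentiableAt one_ne_zero)] at h
  simp only [hx, one_smul, _root_.add_apply, _root_.smul_apply, innerSL_apply_apply,
    real_inner_comm w x, hw, smul_zero] at h
  exact self_eq_neg.mp (eq_neg_of_add_eq_zero_left h)

theorem fderiv_fderiv_norm_of_inner_eq_zero (hx : ‖x‖ = 1) (hw : ⟪w, x⟫ = 0) :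
    D² (fun y : E => ‖y‖) x w w = ‖w‖ ^ 2 := by
  have hx0 : x ≠ 0 := norm_ne_zero_iff.mp (by rw [hx]; exact one_ne_zero)
  have hsq : D² (fun y : E => ‖y‖ ^ 2) x w w = 2 * ‖w‖ ^ 2 := by
    rw [fderiv_norm_sq]
    calc _ = (2 • innerSL ℝ : E →L[ℝ] E →L[ℝ] ℝ) w w :=
          congrArg (fun L : E →L[ℝ] E →L[ℝ] ℝ => L w w)
            (ContinuousLinearMap.fderiv (𝕜 := ℝ) (2 • innerSL ℝ : E →L[ℝ] E →L[ℝ] ℝ))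
      _ = 2 * ‖w‖ ^ 2 := by
          rw [_root_.smul_apply, _root_.smul_apply, innerSL_apply_apply,
            real_inner_self_eq_norm_sq, nsmul_eq_mul, Nat.cast_ofNat]
  rw [show (fun y : E => ‖y‖ ^ 2) = fun y => ‖y‖ * ‖y‖ from funext fun y => sq ‖y‖,
    fderiv_fderiv_mul_self (contDiffAt_norm ℝ hx0) (contDiffAt_norm ℝ hx0),
    fderiv_norm_of_inner_eq_zero hx hw, hx] at hsq
  linarith

end Norm

section Extension

variable {n : ℕ} {φ : Sph n → ℝ} {x : Sph n} {y : Amb n}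

theorem radExt_of_ne (φ : Sph n → ℝ) (hy : y ≠ 0) :
    radExt φ y = φ ⟨‖y‖⁻¹ • y, by simp [norm_smul, hy]⟩ := by
  rw [radExt, dif_pos hy]

theorem exists_eq_smul_coe (hy : y ≠ 0) : ∃ c : ℝ, 0 < c ∧ ∃ x : Sph n, y = c • (x : Amb n) :=
  ⟨‖y‖, norm_pos_iff.mpr hy, ⟨‖y‖⁻¹ • y, by simp [norm_smul, hy]⟩,
    (smul_inv_smul₀ (norm_ne_zero_iff.mpr hy) y).symm⟩

theorem radExt_smul_coe (φ : Sph n → ℝ) {c : ℝ} (hc : 0 < c) (x : Sph n) :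
    radExt φ (c • (x : Amb n)) = φ x := by
  rw [radExt_of_ne φ (smul_ne_zero hc.ne' (ne_zero_of_mem_unit_sphere x))]
  congr 1
  ext1
  simp [norm_smul, abs_of_pos hc, norm_eq_of_mem_sphere x, smul_smul, hc.ne']

theorem radExt_coe (φ : Sph n → ℝ) (x : Sph n) : radExt φ x = φ x := by
  simpa using radExt_smul_coe φ one_pos x

theorem radExt_smul (φ : Sph n → ℝ) {c : ℝ} (hc : 0 < c) (hy : y ≠ 0) :
    radExt φ (c • y) = radExt φ y := by
  obtain ⟨d, hd, x, rfl⟩ := exists_eq_smul_coe hy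
  rw [smul_smul, radExt_smul_coe φ (mul_pos hc hd), radExt_smul_coe φ hd]

theorem radExt_neg (hφ : IsEven φ) (y : Amb n) : radExt φ (-y) = radExt φ y := by
  rcases eq_or_ne y 0 with rfl | hy
  · rw [neg_zero]
  obtain ⟨c, hc, x, rfl⟩ := exists_eq_smul_coe hy
  rw [← smul_neg, radExt_smul_coe φ hc, ← hφ x, ← radExt_smul_coe φ hc (-x)]
  rfl

theorem contDiffAt_radExt {k : WithTop ℕ∞} (hφ : ContMDiff (𝓡 n) 𝓘(ℝ, ℝ) k φ) (hy : y ≠ 0) :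
    ContDiffAt ℝ k (radExt φ) y := by
  have : Fact (finrank ℝ (Amb n) = n + 1) := ⟨finrank_euclideanSpace_fin⟩
  let O : TopologicalSpace.Opens (Amb n) := ⟨{z | z ≠ 0}, isOpen_ne⟩
  have hnormalize : ContMDiff 𝓘(ℝ, Amb n) 𝓘(ℝ, Amb n) k
      fun z : O => ‖(z : Amb n)‖⁻¹ • (z : Amb n) :=
    fun z => contMDiffAt_subtype_iff.mpr (ContDiffAt.contMDiffAt
      (((contDiffAt_norm ℝ z.2).inv (norm_ne_zero_iff.mpr z.2)).smul contDiffAt_id))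
  have hcomp := hφ.comp (hnormalize.codRestrict_sphere (n := n) fun z => by
    simp [norm_smul, show (z : Amb n) ≠ 0 from z.2])
  refine contMDiffAt_iff_contDiffAt.mp ((contMDiffAt_subtype_iff (U := O) (x := ⟨y, hy⟩)).mp
    ((hcomp ⟨y, hy⟩).congr_of_eventuallyEq (Eventually.of_forall fun z => ?_)))
  exact radExt_of_ne φ z.2

/-- The one-homogeneous extension `y ↦ |y| φ (y / |y|)` of a function on the sphere. -/
noncomputable def homExt (φ : Sph n → ℝ) (y : Amb n) : ℝ := ‖y‖ * radExt φ y

theorem homExt_coe (φ : Sph n → ℝ) (x : Sph n) : homExt φ x = φ x := by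
  rw [homExt, norm_eq_of_mem_sphere x, one_mul, radExt_coe]

theorem homExt_smul (φ : Sph n → ℝ) {c : ℝ} (hc : 0 < c) (hy : y ≠ 0) :
    homExt φ (c • y) = c • homExt φ y := by
  rw [homExt, homExt, radExt_smul φ hc hy, norm_smul, Real.norm_of_nonneg hc.le, mul_assoc,
    smul_eq_mul]

theorem homExt_neg (hφ : IsEven φ) (y : Amb n) : homExt φ (-y) = homExt φ y := by
  rw [homExt, homExt, norm_neg, radExt_neg hφ]

theorem contDiffAt_homExt {k : WithTop ℕ∞} (hφ : ContMDiff (𝓡 n) 𝓘(ℝ, ℝ) k φ) (hy : y ≠ 0) :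
    ContDiffAt ℝ k (homExt φ) y :=
  (contDiffAt_norm ℝ hy).mul (contDiffAt_radExt hφ hy)

end Extension

section Operators

variable {n : ℕ} {φ : Sph n → ℝ} {x : Sph n}

theorem mem_tan_iff {v : Amb n} : v ∈ Tan x ↔ ⟪v, (x : Amb n)⟫ = 0 :=
  Submodule.mem_orthogonal_singleton_iff_inner_left

theorem fderiv_radExt_self (hφ : ContDiffAt ℝ 1 (radExt φ) x) :
    fderiv ℝ (radExt φ) x (x : Amb n) = 0 := by
  simpa using fderiv_self_of_homogeneous (a := fun _ => 1)
    (fun c hc => by rw [radExt_smul φ hc (ne_zero_of_mem_unit_sphere x), one_smul])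
    (hasDerivAt_const 1 1) (hφ.differentiableAt one_ne_zero)

theorem coe_grad (hφ : ContDiffAt ℝ 1 (radExt φ) x) : (grad φ x : Amb n) = ∇ (radExt φ) x :=
  Submodule.starProjection_eq_self_iff.mpr
    (mem_tan_iff.mpr (by rw [gradField, inner_gradient_left, fderiv_radExt_self hφ]))

theorem inner_grad (hφ : ContDiffAt ℝ 1 (radExt φ) x) (v : Amb n) :
    ⟪(grad φ x : Amb n), v⟫ = fderiv ℝ (radExt φ) x v := by
  rw [coe_grad hφ, inner_gradient_left]

theorem inner_hess (hφ : ContDiffAt ℝ 2 (radExt φ) x) (v w : Tan x) :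
    ⟪hess φ x v, w⟫ = D² (radExt φ) x v w :=
  (Submodule.inner_orthogonalProjectionOnto_eq_of_mem_right w _).trans
    (inner_fderiv_gradient hφ _ _)

theorem fderiv_homExt_of_mem_tan (hφ : ContDiffAt ℝ 1 (radExt φ) x) {v : Amb n} (hv : v ∈ Tan x) :
    fderiv ℝ (homExt φ) x v = fderiv ℝ (radExt φ) x v := by
  have hx := norm_eq_of_mem_sphere x
  unfold homExt
  rw [fderiv_fun_mul ((contDiffAt_norm ℝ (ne_zero_of_mem_unit_sphere x)).differentiableAt
    one_ne_zero) (hφ.differentiableAt one_ne_zero)]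
  simp [hx, fderiv_norm_of_inner_eq_zero hx (mem_tan_iff.mp hv)]

theorem fderiv_fderiv_homExt_of_mem_tan (hφ : ContDiffAt ℝ 2 (radExt φ) x) {v : Amb n}
    (hv : v ∈ Tan x) :
    D² (homExt φ) x v v = D² (radExt φ) x v v + φ x * ‖v‖ ^ 2 := by
  have hx := norm_eq_of_mem_sphere x
  unfold homExt
  rw [fderiv_fderiv_mul_self (contDiffAt_norm ℝ (ne_zero_of_mem_unit_sphere x)) hφ, hx,
    fderiv_norm_of_inner_eq_zero hx (mem_tan_iff.mp hv),
    fderiv_fderiv_norm_of_inner_eq_zero hx (mem_tan_iff.mp hv), radExt_coe]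
  ring

theorem fderiv_homExt_self (hφ : ContDiffAt ℝ 1 (radExt φ) x) :
    fderiv ℝ (homExt φ) x (x : Amb n) = φ x := by
  have hx := ne_zero_of_mem_unit_sphere x
  simpa [homExt_coe] using fderiv_self_of_homogeneous (fun c hc => homExt_smul φ hc hx)
    (hasDerivAt_id 1)
    (((contDiffAt_norm ℝ hx).mul hφ).differentiableAt one_ne_zero)

theorem gradient_homExt (hφ : ContDiffAt ℝ 1 (radExt φ) x) :
    ∇ (homExt φ) x = (grad φ x : Amb n) + φ x • (x : Amb n) := by
  refine ext_inner_right ℝ fun v => ?_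
  have hv : v - ⟪v, (x : Amb n)⟫ • (x : Amb n) ∈ Tan x := by
    simp [mem_tan_iff, inner_sub_left, real_inner_smul_left, norm_eq_of_mem_sphere x]
  have h := fderiv_homExt_of_mem_tan hφ hv
  rw [map_sub, map_sub, map_smul, map_smul, fderiv_radExt_self hφ, fderiv_homExt_self hφ,
    smul_zero, sub_zero, smul_eq_mul] at h
  rw [inner_gradient_left, inner_add_left, inner_grad hφ, real_inner_smul_left,
    real_inner_comm]
  linarith

theorem norm_sq_gradient_homExt (hφ : ContDiffAt ℝ 1 (radExt φ) x) :
    ‖∇ (homExt φ) x‖ ^ 2 = ‖grad φ x‖ ^ 2 + φ x ^ 2 := by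
  rw [gradient_homExt hφ, norm_add_sq_real, real_inner_smul_right, mem_tan_iff.mp (grad φ x).2,
    norm_smul, norm_eq_of_mem_sphere x, Submodule.coe_norm, mul_one, Real.norm_eq_abs, sq_abs]
  ring

theorem inner_U (hφ : ContDiffAt ℝ 2 (radExt φ) x) (hpos : 0 < φ x) (v : Tan x) :
    ⟪U φ x v, v⟫ = D² (homExt φ) x v v - horoCosh (homExt φ) x * ‖v‖ ^ 2 := by
  rw [fderiv_fderiv_homExt_of_mem_tan hφ v.2, horoCosh,
    norm_sq_gradient_homExt (hφ.of_le one_le_two), homExt_coe, ← inner_hess hφ]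
  simp only [U, LinearMap.add_apply, LinearMap.sub_apply, LinearMap.smul_apply, LinearMap.id_apply,
    inner_add_left, inner_sub_left, real_inner_smul_left, real_inner_self_eq_norm_sq,
    Submodule.coe_norm]
  have := hpos.ne'
  field_simp
  ring

end Operators

section Trace

variable {E : Type*} [NormedAddCommGroup E] [InnerProductSpace ℝ E] [FiniteDimensional ℝ E]
  {Φ : E → ℝ} {x : E}

theorem trace_fderiv_gradient (h : ContDiffAt ℝ 2 Φ x) :
    LinearMap.trace ℝ E (fderiv ℝ (∇ Φ) x : E →ₗ[ℝ] E) = Δ Φ x := by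
  rw [LinearMap.trace_eq_sum_inner _ (stdOrthonormalBasis ℝ E),
    laplacian_eq_sum_fderiv_fderiv (stdOrthonormalBasis ℝ E)]
  exact Finset.sum_congr rfl fun i _ =>
    (real_inner_comm _ _).trans (inner_fderiv_gradient h _ _)

theorem trace_orthogonal_compression (hx : ‖x‖ = 1) (M : E →ₗ[ℝ] E) :
    LinearMap.trace ℝ (ℝ ∙ x)ᗮ
        (((ℝ ∙ x)ᗮ.orthogonalProjectionOnto : E →ₗ[ℝ] (ℝ ∙ x)ᗮ) ∘ₗ M ∘ₗ (ℝ ∙ x)ᗮ.subtype)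
      = LinearMap.trace ℝ E M - ⟪x, M x⟫ := by
  let b := stdOrthonormalBasis ℝ E
  have hproj (v : E) : ((ℝ ∙ x)ᗮ.orthogonalProjectionOnto v : E) = v - ⟪x, v⟫ • x := by
    rw [← Submodule.starProjection_unit_singleton ℝ hx v]
    exact Submodule.starProjection_orthogonal_val v
  rw [LinearMap.trace_comp_comm', LinearMap.trace_eq_sum_inner _ b,
    LinearMap.trace_eq_sum_inner _ b, ← b.sum_inner_mul_inner x (M x), ← Finset.sum_sub_distrib]
  refine Finset.sum_congr rfl fun i _ => ?_
  simp [hproj, inner_sub_right, real_inner_smul_right]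

end Trace

section Equation

variable {n : ℕ} {f φ : Sph n → ℝ} {x : Sph n}

theorem finrank_tan (x : Sph n) : finrank ℝ (Tan x) = n := by
  have : Fact (finrank ℝ (Amb n) = n + 1) := ⟨finrank_euclideanSpace_fin⟩
  exact Submodule.finrank_orthogonal_span_singleton (ne_zero_of_mem_unit_sphere x)

theorem laplacian_homExt (hφ : ContMDiff (𝓡 n) 𝓘(ℝ, ℝ) 2 φ) (x : Sph n) :
    Δ (homExt φ) x = lap φ x + n * φ x := by
  have hx := ne_zero_of_mem_unit_sphere x
  have hΦ := contDiffAt_homExt hφ hx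
  let c := stdOrthonormalBasis ℝ (Tan x)
  have hsum : LinearMap.trace ℝ (Tan x) (((Tan x).orthogonalProjectionOnto : Amb n →ₗ[ℝ] Tan x)
      ∘ₗ (fderiv ℝ (∇ (homExt φ)) x : Amb n →ₗ[ℝ] Amb n) ∘ₗ (Tan x).subtype)
        = lap φ x + n * φ x := by
    have hterm (k) : ⟪c k, (Tan x).orthogonalProjectionOnto (fderiv ℝ (∇ (homExt φ)) x (c k))⟫
        = ⟪c k, hess φ x (c k)⟫ + φ x := by
      rw [real_inner_comm, Submodule.inner_orthogonalProjectionOnto_eq_of_mem_right,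
        inner_fderiv_gradient hΦ, fderiv_fderiv_homExt_of_mem_tan (contDiffAt_radExt hφ hx) (c k).2,
        real_inner_comm, inner_hess (contDiffAt_radExt hφ hx), ← Submodule.coe_norm,
        c.norm_eq_one, one_pow, mul_one]
    rw [LinearMap.trace_eq_sum_inner _ c, lap, LinearMap.trace_eq_sum_inner _ c]
    refine (Finset.sum_congr rfl fun k _ => hterm k).trans ?_
    simp [Finset.sum_add_distrib, finrank_tan]
  have hradial : D² (homExt φ) x (x : Amb n) = 0 := by
    simpa using fderiv_self_of_homogeneous (a := fun _ => 1)
      (fun c hc => by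
        rw [fderiv_smul_of_homogeneous hc.ne' (fun z hz => homExt_smul φ hc hz) hx,
          inv_mul_cancel₀ hc.ne'])
      (hasDerivAt_const 1 1) (differentiableAt_fderiv hΦ)
  rw [← trace_fderiv_gradient hΦ, ← hsum, trace_orthogonal_compression (norm_eq_of_mem_sphere x),
    ContinuousLinearMap.coe_coe, real_inner_comm, inner_fderiv_gradient hΦ, hradial,
    _root_.zero_apply, sub_zero]

theorem IsHConvexSolution.isHoroConvex (h : IsHConvexSolution f φ) : IsHoroConvex (homExt φ) where
  contDiffAt _ hy := contDiffAt_homExt h.1.contMDiff hy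
  pos y hy := by
    obtain ⟨c, hc, x, rfl⟩ := exists_eq_smul_coe hy
    rw [homExt_smul φ hc (ne_zero_of_mem_unit_sphere x), homExt_coe]
    exact mul_pos hc (h.1.pos x)
  homogeneous c hc y hy := homExt_smul φ hc hy
  horoCosh_le y v hy hv := by
    lift y to Sph n using by simpa using hy
    have hU := (h.2 y).inner_nonneg_left ⟨v, mem_tan_iff.mpr hv⟩
    rw [inner_U ((contDiffAt_radExt h.1.contMDiff (ne_zero_of_mem_unit_sphere y)).of_le
      (by norm_num)) (h.1.pos y)] at hU
    exact sub_nonneg.mp hU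

theorem IsSolution.horoTrace_coe (h : IsSolution f φ) (x : Sph n) :
    horoTrace (homExt φ) x = (φ x)⁻¹ * f x := by
  have hx := ne_zero_of_mem_unit_sphere x
  have hφ := (h.pos x).ne'
  rw [horoTrace, laplacian_homExt (h.contMDiff.of_le (by norm_num)), finrank_euclideanSpace_fin,
    horoCosh, norm_sq_gradient_homExt ((contDiffAt_radExt h.contMDiff hx).of_le (by norm_num)),
    homExt_coe, ← h.eqn x]
  push_cast
  field_simp
  ring

theorem IsHConvexSolution.horoTrace_eq (h : IsHConvexSolution f φ) {y : Amb n} (hy : y ≠ 0) :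
    horoTrace (homExt φ) y = (homExt φ y * radExt (fun x => (f x)⁻¹) y)⁻¹ := by
  obtain ⟨c, hc, x, rfl⟩ := exists_eq_smul_coe hy
  have hx := ne_zero_of_mem_unit_sphere x
  rw [h.isHoroConvex.horoTrace_smul hc hx, h.1.horoTrace_coe, homExt_smul φ hc hx,
    radExt_smul_coe _ hc, homExt_coe, smul_eq_mul]
  field_simp

end Equation

section LocalExtrema

variable {E : Type*} [NormedAddCommGroup E] [NormedSpace ℝ E] {G : E → ℝ} {x : E}

theorem hasDerivAt_deriv_line (hG : ContDiffAt ℝ 2 G x) (v : E) :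
    HasDerivAt (deriv fun t : ℝ => G (x + t • v)) (D² G x v v) 0 := by
  have hfirst : deriv (fun t : ℝ => G (x + t • v)) =ᶠ[𝓝 0] fun t => fderiv ℝ G (x + t • v) v := by
    filter_upwards [(tendsto_line x v).eventually (hG.eventually (by simp))] with t ht
    exact (hasDerivAt_comp_line (ht.differentiableAt two_ne_zero)).deriv
  have hsecond : HasDerivAt (fun t : ℝ => fderiv ℝ G (x + t • v)) (D² G x v) 0 := by
    simpa using hasDerivAt_comp_line (x := x) (l := v) (t := 0)
      (by simpa using differentiableAt_fderiv hG)
  exact ((hsecond.clm_apply (hasDerivAt_const 0 v)).congr_deriv (by simp)).congr_of_eventuallyEq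
    hfirst

theorem fderiv_fderiv_nonneg_of_isLocalMin (h : IsLocalMin G x) (hG : ContDiffAt ℝ 2 G x) (v : E) :
    0 ≤ D² G x v v := by
  let γ : ℝ → ℝ := fun t => G (x + t • v)
  have hcont : ContinuousAt (fun t : ℝ => x + t • v) 0 := by fun_prop
  have hx : x + (0 : ℝ) • v = x := by simp
  have hmin : IsLocalMin γ 0 := by
    have := hcont.eventually (hx.symm ▸ h)
    simpa [IsLocalMin, IsMinFilter, γ] using this
  by_contra! hneg
  -- If the second derivative were negative, `γ` would also have a local maximum, hence be constant.
  have hmax : IsLocalMax γ 0 := isLocalMax_of_deriv_deriv_neg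
    (by rwa [(hasDerivAt_deriv_line hG v).deriv]) hmin.deriv_eq_zero
    (ContinuousAt.comp (by rw [hx]; exact hG.continuousAt) hcont)
  have hconst : γ =ᶠ[𝓝 0] fun _ => γ 0 := by
    filter_upwards [hmin, hmax] with t h₁ h₂ using le_antisymm h₂ h₁
  have hzero := hconst.deriv.deriv_eq
  rw [(hasDerivAt_deriv_line hG v).deriv] at hzero
  simp only [deriv_const'] at hzero
  exact hneg.ne hzero

end LocalExtrema

section Estimates

variable {n : ℕ} {f φ : Sph n → ℝ} {x : Sph n}

theorem isLocalMax_radExt (h : ∀ z, φ z ≤ φ x) : IsLocalMax (radExt φ) x :=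
  (isOpen_ne.eventually_mem (ne_zero_of_mem_unit_sphere x)).mono fun y hy => by
    rw [radExt_of_ne φ hy, radExt_coe]
    exact h _

theorem isLocalMin_radExt (h : ∀ z, φ x ≤ φ z) : IsLocalMin (radExt φ) x :=
  (isOpen_ne.eventually_mem (ne_zero_of_mem_unit_sphere x)).mono fun y hy => by
    rw [radExt_of_ne φ hy, radExt_coe]
    exact h _

namespace IsHoroConvex

variable (hΦ : IsHoroConvex (homExt φ))
include hΦ

theorem contDiffAt_radExt (x : Sph n) : ContDiffAt ℝ 4 (radExt φ) x := by
  have hx := ne_zero_of_mem_unit_sphere x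
  refine (((contDiffAt_norm ℝ hx).inv (norm_ne_zero_iff.mpr hx)).mul
    (hΦ.contDiffAt x hx)).congr_of_eventuallyEq ?_
  filter_upwards [isOpen_ne.mem_nhds hx] with y hy
  exact (inv_mul_cancel_left₀ (norm_ne_zero_iff.mpr hy) _).symm

theorem pos_coe (x : Sph n) : 0 < φ x := homExt_coe φ x ▸ hΦ.pos x (ne_zero_of_mem_unit_sphere x)

theorem one_add_fderiv_radExt_sq_le (heven : IsEven φ) {v : Tan x} (hv : ‖v‖ = 1) :
    1 + fderiv ℝ (radExt φ) x v ^ 2 ≤ φ x ^ 2 := by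
  rw [← fderiv_homExt_of_mem_tan ((hΦ.contDiffAt_radExt x).of_le (by norm_num)) v.2,
    ← homExt_coe φ x]
  exact hΦ.one_add_fderiv_sq_le (homExt_neg heven) (norm_eq_of_mem_sphere x) hv
    (mem_tan_iff.mp v.2)

theorem norm_grad_le (heven : IsEven φ) (x : Sph n) : ‖grad φ x‖ ≤ φ x := by
  rcases eq_or_ne (grad φ x) 0 with h | h
  · rw [h, norm_zero]
    exact (hΦ.pos_coe x).le
  have hgrad := norm_ne_zero_iff.mpr h
  have hle := hΦ.one_add_fderiv_radExt_sq_le heven (norm_smul_inv_norm (𝕜 := ℝ) h)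
  rw [← inner_grad ((hΦ.contDiffAt_radExt x).of_le (by norm_num)), Submodule.coe_smul,
    real_inner_smul_right, real_inner_self_eq_norm_sq, RCLike.ofReal_real_eq_id, id_eq,
    ← Submodule.coe_norm, sq ‖_‖, inv_mul_cancel_left₀ hgrad] at hle
  exact (sq_le_sq₀ (norm_nonneg _) (hΦ.pos_coe x).le).mp (by linarith)

theorem one_le (hn : 1 ≤ n) (heven : IsEven φ) (x : Sph n) : 1 ≤ φ x := by
  have : Nontrivial (Tan x) := finrank_pos_iff (R := ℝ).mp (by rw [finrank_tan]; exact hn)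
  obtain ⟨v, hv⟩ := exists_norm_eq (Tan x) zero_le_one
  have hle := hΦ.one_add_fderiv_radExt_sq_le heven hv
  exact (one_le_sq_iff₀ (hΦ.pos_coe x).le).mp (by linarith [sq_nonneg (fderiv ℝ (radExt φ) x v)])

theorem one_add_sq_le_of_forall_le (hn : 1 ≤ n) (heven : IsEven φ) (hmax : ∀ z, φ z ≤ φ x)
    (y : Sph n) : 1 + φ x ^ 2 ≤ 2 * φ x * φ y := by
  wlog hyx : 0 ≤ ⟪(y : Amb n), (x : Amb n)⟫ generalizing y
  · have hneg := this (-y) (by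
      rw [show ((-y : Sph n) : Amb n) = -y from rfl, inner_neg_left]
      linarith)
    rwa [heven y] at hneg
  have hcrit (v : Amb n) (hv : ⟪v, (x : Amb n)⟫ = 0) : fderiv ℝ (homExt φ) x v = 0 := by
    rw [fderiv_homExt_of_mem_tan ((hΦ.contDiffAt_radExt x).of_le (by norm_num))
      (mem_tan_iff.mpr hv), (isLocalMax_radExt hmax).fderiv_eq_zero, _root_.zero_apply]
  have hx : 1 ≤ homExt φ x := by
    rw [homExt_coe]
    exact hΦ.one_le hn heven x
  simpa only [homExt_coe] using hΦ.one_add_sq_le_of_critical (norm_eq_of_mem_sphere x) hx hcrit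
    (norm_eq_of_mem_sphere y) hyx

end IsHoroConvex

theorem lap_nonneg_of_forall_le (hφ : ContDiffAt ℝ 2 (radExt φ) x) (hmin : ∀ z, φ x ≤ φ z) :
    0 ≤ lap φ x := by
  rw [lap, LinearMap.trace_eq_sum_inner _ (stdOrthonormalBasis ℝ (Tan x))]
  refine Finset.sum_nonneg fun i _ => ?_
  rw [real_inner_comm, inner_hess hφ]
  exact fderiv_fderiv_nonneg_of_isLocalMin (isLocalMin_radExt hmin) hφ _

theorem IsSolution.mul_sq_le_of_forall_le (h : IsSolution f φ) (hmin : ∀ z, φ x ≤ φ z) :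
    n * φ x ^ 2 ≤ 2 * f x + n := by
  have hφ : ContDiffAt ℝ 2 (radExt φ) x :=
    (contDiffAt_radExt h.contMDiff (ne_zero_of_mem_unit_sphere x)).of_le (by norm_num)
  have hgrad : (grad φ x : Amb n) = 0 := by
    rw [coe_grad (hφ.of_le one_le_two), gradient, (isLocalMin_radExt hmin).fderiv_eq_zero, map_zero]
  have hpos := h.pos x
  have heq := h.eqn x
  rw [Submodule.coe_norm, hgrad, norm_zero] at heq
  field_simp at heq
  nlinarith [mul_nonneg hpos.le (lap_nonneg_of_forall_le hφ hmin)]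

theorem IsHConvexSolution.sq_lt (hn : 1 ≤ n) (hf : Continuous f) (heven : IsEven φ)
    (h : IsHConvexSolution f φ) (x : Sph n) : φ x ^ 2 < 8 / (n : ℝ) * (⨆ y, f y) + 2 := by
  have : Nonempty (Sph n) := ⟨x⟩
  have hcont := h.1.contMDiff.continuous
  obtain ⟨xmax, hmax⟩ := hcont.exists_forall_ge_of_hasCompactSupport (.of_compactSpace φ)
  obtain ⟨xmin, hmin⟩ := hcont.exists_forall_le_of_hasCompactSupport (.of_compactSpace φ)
  have hpos := h.1.pos
  have hmaxmin := h.isHoroConvex.one_add_sq_le_of_forall_le hn heven hmax xmin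
  have hmax_sq : φ xmax ^ 2 < 4 * φ xmin ^ 2 - 2 := by
    have hsq := pow_le_pow_left₀ (by positivity) hmaxmin 2
    refine lt_of_mul_lt_mul_left ?_ (sq_nonneg (φ xmax))
    linarith
  have hmin_sq : φ xmin ^ 2 ≤ 2 / n * (⨆ y, f y) + 1 := by
    have hsup : f xmin ≤ ⨆ y, f y := le_ciSup (isCompact_range hf).bddAbove xmin
    have hn₀ : (0 : ℝ) < n := by exact_mod_cast hn
    rw [show 2 / (n : ℝ) * (⨆ y, f y) + 1 = (2 * (⨆ y, f y) + n) / n by field_simp,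
      le_div_iff₀' hn₀]
    linarith [h.1.mul_sq_le_of_forall_le hmin]
  calc φ x ^ 2 ≤ φ xmax ^ 2 := pow_le_pow_left₀ (hpos x).le (hmax x) 2
    _ < 4 * φ xmin ^ 2 - 2 := hmax_sq
    _ ≤ 4 * (2 / n * (⨆ y, f y) + 1) - 2 := by linarith
    _ = 8 / (n : ℝ) * (⨆ y, f y) + 2 := by ring

end Estimates

section Rank

variable {n : ℕ} {f φ ψ : Sph n → ℝ} {x : Sph n}

theorem fderiv_radExt_gradient_homExt_sub_le (hψ : ContDiffAt ℝ 1 (radExt ψ) x)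
    (hφ : ContDiffAt ℝ 1 (radExt φ) x) {e : Tan x} (he : ‖e‖ = 1) :
    fderiv ℝ (radExt ψ) x (∇ (homExt φ) x)
      - 2 * (fderiv ℝ (homExt φ) x e * fderiv ℝ (radExt ψ) x e) ≤ ‖grad ψ x‖ * ‖grad φ x‖ := by
  have hreflection : (ℝ ∙ e)ᗮ.reflection (grad φ x) = grad φ x - (2 * ⟪e, grad φ x⟫) • e := by
    rw [Submodule.reflection_orthogonal_apply, Submodule.reflection_singleton_apply, he]
    module
  calc fderiv ℝ (radExt ψ) x (∇ (homExt φ) x)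
      - 2 * (fderiv ℝ (homExt φ) x e * fderiv ℝ (radExt ψ) x e)
    _ = ⟪grad ψ x, (ℝ ∙ e)ᗮ.reflection (grad φ x)⟫ := by
      rw [gradient_homExt hφ, map_add, map_smul, fderiv_radExt_self hψ,
        fderiv_homExt_of_mem_tan hφ e.2, ← inner_grad hψ, ← inner_grad hψ, ← inner_grad hφ,
        hreflection, inner_sub_right, real_inner_smul_right, real_inner_comm (grad φ x) e]
      simp only [smul_zero, add_zero, Submodule.coe_inner]
      ring
    _ ≤ ‖grad ψ x‖ * ‖(ℝ ∙ e)ᗮ.reflection (grad φ x)‖ := real_inner_le_norm _ _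
    _ = ‖grad ψ x‖ * ‖grad φ x‖ := by rw [LinearIsometryEquiv.norm_map]

theorem CurvCondition.norm_grad_le (hf : CurvCondition f)
    (hsmooth : ContDiffAt ℝ 2 (radExt fun y => (f y)⁻¹) x) {e : Tan x} (he : ‖e‖ = 1) :
    ‖grad (fun y => (f y)⁻¹) x‖ ≤ D² (radExt fun y => (f y)⁻¹) x e e
      + (f x)⁻¹ / (8 / (n : ℝ) * (⨆ y, f y) + 2) := by
  have h := (hf x).inner_nonneg_left e
  simp only [LinearMap.add_apply, LinearMap.sub_apply, LinearMap.smul_apply, LinearMap.id_apply,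
    inner_add_left, inner_sub_left, real_inner_smul_left, real_inner_self_eq_norm_sq, he,
    inner_hess hsmooth] at h
  linarith

theorem isNullDirection_of_inner_U_eq_zero (hφ : ContDiffAt ℝ 2 (radExt φ) x) (hpos : 0 < φ x)
    {e : Tan x} (he : ‖e‖ = 1) (hU : ⟪U φ x e, e⟫ = 0) : IsNullDirection (homExt φ) x e where
  norm_point := norm_eq_of_mem_sphere x
  norm_eq := he
  inner_eq := mem_tan_iff.mp e.2
  hess_eq := by
    rw [inner_U hφ hpos, he] at hU
    linarith

theorem IsHConvexSolution.inner_U_ne_zero (hn : 1 ≤ n) (hf : ContMDiff (𝓡 n) 𝓘(ℝ, ℝ) 2 f)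
    (hf_pos : ∀ x, 0 < f x) (hf_cond : CurvCondition f) (heven : IsEven φ)
    (h : IsHConvexSolution f φ) {e : Tan x} (he : ‖e‖ = 1) : ⟪U φ x e, e⟫ ≠ 0 := by
  intro hU
  have hx := ne_zero_of_mem_unit_sphere x
  have hφ : ContDiffAt ℝ 2 (radExt φ) x :=
    (contDiffAt_radExt h.1.contMDiff hx).of_le (by norm_num)
  have hg := contDiffAt_radExt (hf.inv₀ fun y => (hf_pos y).ne') hx
  have hgx : 0 < (f x)⁻¹ := inv_pos.mpr (hf_pos x)
  have hφx := h.1.pos x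
  have hbarrier := (isNullDirection_of_inner_U_eq_zero hφ hφx he hU).fderiv_fderiv_le
    h.isHoroConvex hg (by rwa [radExt_coe])
    (eventually_ne_nhds hx |>.mono fun y hy => h.horoTrace_eq hy)
  have hgrad_inner := fderiv_radExt_gradient_homExt_sub_le (hg.of_le one_le_two)
    (hφ.of_le one_le_two) he
  have hgrad := hf_cond.norm_grad_le hg he
  rw [homExt_coe, radExt_coe] at hbarrier
  have hstrict : φ x ^ 2 * ((f x)⁻¹ / (8 / (n : ℝ) * (⨆ y, f y) + 2)) < (f x)⁻¹ := by
    have hc := h.sq_lt hn hf.continuous heven x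
    rw [mul_div_left_comm]
    exact mul_lt_of_lt_one_right hgx ((div_lt_one ((sq_nonneg _).trans_lt hc)).mpr hc)
  have hupper : φ x ^ 2 * D² (radExt fun y => (f y)⁻¹) x e e + (f x)⁻¹
      ≤ φ x ^ 2 * ‖grad (fun y => (f y)⁻¹) x‖ :=
    calc _ ≤ φ x * (‖grad (fun y => (f y)⁻¹) x‖ * ‖grad φ x‖) :=
          hbarrier.trans (mul_le_mul_of_nonneg_left hgrad_inner hφx.le)
      _ ≤ φ x * (‖grad (fun y => (f y)⁻¹) x‖ * φ x) := by
          gcongr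
          exact h.isHoroConvex.norm_grad_le heven x
      _ = _ := by ring
  linarith [mul_le_mul_of_nonneg_left hgrad (sq_nonneg (φ x))]

theorem posDef_of_inner_ne_zero {V : Type*} [NormedAddCommGroup V] [InnerProductSpace ℝ V]
    {A : V →ₗ[ℝ] V} (hA : A.IsPositive) (h : ∀ e, ‖e‖ = 1 → ⟪A e, e⟫ ≠ 0) : PosDef A := by
  refine ⟨hA.isSymmetric, fun v hv => (hA.inner_nonneg_left v).lt_of_ne' fun hzero => ?_⟩
  refine h _ (norm_smul_inv_norm (𝕜 := ℝ) hv) ?_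
  rw [map_smul, real_inner_smul_left, real_inner_smul_right, hzero, mul_zero, mul_zero]

end Rank

end HypChristoffel

theorem theorem4p1_general (n : ℕ) (hn : 1 ≤ n)
    (f : HypChristoffel.Sph n → ℝ)
    (hf_smooth : ContMDiff (𝓡 n) 𝓘(ℝ, ℝ) 2 f)
    (hf_pos : ∀ x, 0 < f x)
    (hf_cond : HypChristoffel.CurvCondition f)
    (φ : HypChristoffel.Sph n → ℝ)
    (hφ_even : HypChristoffel.IsEven φ)
    (hφ : HypChristoffel.IsHConvexSolution f φ) :
    HypChristoffel.IsUniformlyHConvexSolution f φ :=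
  ⟨hφ.1, fun x => HypChristoffel.posDef_of_inner_ne_zero (hφ.2 x) fun _ he =>
    hφ.inner_U_ne_zero hn hf_smooth hf_pos hf_cond hφ_even he⟩

theorem theorem4p1 (n : ℕ) (hn : 1 ≤ n)
    (f : HypChristoffel.Sph n → ℝ)
    (hf_smooth : ContMDiff (𝓡 n) 𝓘(ℝ, ℝ) ∞ f)
    (hf_pos : ∀ x, 0 < f x)
    (hf_even : HypChristoffel.IsEven f)
    (hf_cond : HypChristoffel.CurvCondition f)
    (φ : HypChristoffel.Sph n → ℝ)
    (hφ_even : HypChristoffel.IsEven φ)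
    (hφ : HypChristoffel.IsHConvexSolution f φ)
    (hφ_int : HypChristoffel.IntegralIdentity φ) :
    HypChristoffel.IsEven φ ∧ HypChristoffel.IsUniformlyHConvexSolution f φ :=
  ⟨hφ_even, theorem4p1_general n hn f (hf_smooth.of_le ENat.LEInfty.out) hf_pos hf_cond φ
    hφ_even hφ⟩
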